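/- Let $M$ be a one-manifold, i.e. a space homeomorphic to $\mathbb{R}$, $[0,1)$, $[0,1]$ or $S^1$, let $G$ be a finitely generated virtually nilpotent group, and let $\varphi,\psi\colon G\to\mathrm{Homeo}_+(M)$ be actions by orientation-preserving homeomorphisms. An *interval decomposition* for $\varphi$ consists of two countable collections $\{I_i\}$, $\{M_i\}$ of nonempty open subsets of $M$, pairwise disjoint (within and across the collections), each $\varphi(G)$-invariant, with $\bigcup_i I_i\cup\bigcup_i M_i$ dense in $M$, such that, writing $I_{i,j}$, $M_{i,j}$ for the connected components of $I_i$, $M_i$: - every $I_{i,j}$ is an open interval (an open set homeomorphic to $\mathbb{R}$); for all $j,j'$ some $g\in G$ has $\varphi(g)(I_{i,j})=I_{i,j'}$; and if $\varphi(g)(I_{i,j})=I_{i,j}$ then $\varphi(g)$ is the identity on $I_{i,j}$; - either all components $M_{i,j}$ of $M_i$ are open intervals, or $M$ is a circle and $M_i=M$; - every $\varphi(G)$-orbit of a point of $M_i$ is dense in $M_i$; - the group of restrictions to $M_{i,j}$ of those $\varphi(g)$ with $\varphi(g)(M_{i,j})=M_{i,j}$ is abelian (in particular $\varphi(G)$ is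 abelian if $M_i=M=S^1$). Given decompositions for $\varphi$ and $\psi$, say that a homeomorphism $h$ of $M$ *carries* the first to the second if $K\mapsto h(K)$ maps the set of all $(I_{i,j})_\varphi$ onto the set of all $(I_{i,j})_\psi$, and the set of all $(M_{i,j})_\varphi$ onto the set of all $(M_{i,j})_\psi$, and $h(\varphi(g)x)=\psi(g)h(x)$ for all $g\in G$ and all $x$ in one of the $(I_{i,j})_\varphi$, $(M_{i,j})_\varphi$. Then: 1. $\varphi$ and $\psi$ are topologically conjugate (there is a homeomorphism $h$ of $M$ with $h\varphi(g)=\psi(g)h$ for all $g\in G$) if and only if there are an interval decomposition for $\varphi$, an interval decomposition for $\psi$ and a homeomorphism of $M$ carrying the first to the second. 2. Moreover, the decomposition for $\varphi$ may be prescribed: for every interval decomposition for $\varphi$, the actions $\varphi$ and $\psi$ are topologically conjugate if and only if some homeomorphism of $M$ carries this decomposition to some interval decomposition for $\psi$. 3. In particular, suppose a homeomorphism $h$ of $M$ carries an interval decomposition for $\varphi$ to one for $\psi$, and let $K=(M_{i,j})_\varphi$ be an open interval. Then $\{g:\varphi(g)(K)=K\}=\{g:\psi(g)(h(K))=h(K)\}=:G_K$;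 there are homeomorphisms $p\colon K\to\mathbb{R}$ and $q\colon h(K)\to\mathbb{R}$ and functions $\tau,\sigma\colon G_K\to\mathbb{R}$ with $p\,\varphi(g)\,p^{-1}(t)=t+\tau(g)$ and $q\,\psi(g)\,q^{-1}(t)=t+\sigma(g)$ for all $g\in G_K$ and $t\in\mathbb{R}$; and for any such $p,q,\tau,\sigma$ there is a constant $c\neq0$ with $\sigma(g)=c\,\tau(g)$ for all $g\in G_K$. That is, the two restricted actions are conjugate groups of translations whose elements have the same translation numbers relative to each other. -/

import Mathlib

namespace OneDimAction

/-- A (connected) one-manifold, possibly with boundary: a space homeomorphic to the line, the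
half-open interval, the closed interval or the circle. -/
def IsOneManifold (M : Type*) [TopologicalSpace M] : Prop :=
  Nonempty (M ≃ₜ ℝ) ∨ Nonempty (M ≃ₜ Set.Ico (0 : ℝ) 1) ∨
    Nonempty (M ≃ₜ Set.Icc (0 : ℝ) 1) ∨ Nonempty (M ≃ₜ UnitAddCircle)

section

variable {M : Type*} [TopologicalSpace M]

/-- A homeomorphism of a one-manifold is orientation-preserving if, after identifying the manifold
with one of the four models, it is strictly increasing (line and intervals) or lifts to an
increasing bijection of the line (circle). Only one of the four clauses is not void, and the
condition in it does not depend on the identification chosen. -/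
def IsOrientationPreserving (f : M ≃ₜ M) : Prop :=
  (∀ (e : M ≃ₜ ℝ) (x y : M), e x < e y → e (f x) < e (f y)) ∧
  (∀ (e : M ≃ₜ Set.Ico (0 : ℝ) 1) (x y : M), e x < e y → e (f x) < e (f y)) ∧
  (∀ (e : M ≃ₜ Set.Icc (0 : ℝ) 1) (x y : M), e x < e y → e (f x) < e (f y)) ∧
  (∀ e : M ≃ₜ UnitAddCircle, ∃ F : ℝ ≃o ℝ, ∀ t : ℝ,
    e (f (e.symm (t : UnitAddCircle))) = ((F t : ℝ) : UnitAddCircle))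

theorem lt_symm_of_lt {α : Type*} [TopologicalSpace α] [LinearOrder α] (e : M ≃ₜ α) (f : M ≃ₜ M)
    (h : ∀ x y : M, e x < e y → e (f x) < e (f y)) (x y : M) (hxy : e x < e y) :
    e (f.symm x) < e (f.symm y) := by
  rcases lt_trichotomy (e (f.symm x)) (e (f.symm y)) with h1 | h1 | h1
  · exact h1
  · have h2 : x = y := f.symm.injective (e.injective h1)
    subst h2
    exact absurd hxy (lt_irrefl _)
  · have h2 := h _ _ h1
    simp only [Homeomorph.apply_symm_apply] at h2
    exact absurd hxy (lt_asymm h2)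

variable (M) in
/-- The group of orientation-preserving homeomorphisms of a one-manifold. -/
def HomeoPlus : Subgroup (M ≃ₜ M) where
  carrier := {f | IsOrientationPreserving f}
  one_mem' := ⟨fun _ _ _ h => h, fun _ _ _ h => h, fun _ _ _ h => h,
    fun e => ⟨OrderIso.refl ℝ, fun t => by simp⟩⟩
  mul_mem' := by
    rintro f g ⟨f1, f2, f3, f4⟩ ⟨g1, g2, g3, g4⟩
    refine ⟨fun e x y h => f1 e _ _ (g1 e _ _ h), fun e x y h => f2 e _ _ (g2 e _ _ h),
      fun e x y h => f3 e _ _ (g3 e _ _ h), fun e => ?_⟩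
    obtain ⟨F, hF⟩ := f4 e
    obtain ⟨K, hK⟩ := g4 e
    refine ⟨K.trans F, fun t => ?_⟩
    rw [OrderIso.trans_apply, ← hF, ← hK]
    simp
  inv_mem' := by
    rintro f ⟨f1, f2, f3, f4⟩
    refine ⟨fun e => lt_symm_of_lt e f (f1 e), fun e => lt_symm_of_lt e f (f2 e),
      fun e => lt_symm_of_lt e f (f3 e), fun e => ?_⟩
    obtain ⟨F, hF⟩ := f4 e
    refine ⟨F.symm, fun t => ?_⟩
    have h := hF (F.symm t)
    rw [OrderIso.apply_symm_apply] at h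
    rw [← h]
    change e (f.symm _) = _
    simp

/-- A set is an open interval if it is open and homeomorphic to the line. -/
def IsOpenInterval (K : Set M) : Prop := IsOpen K ∧ Nonempty (K ≃ₜ ℝ)

/-- The connected components of a subset. -/
def components (U : Set M) : Set (Set M) := {K | ∃ x ∈ U, K = connectedComponentIn U x}

/-- The connected components of the members of a collection of sets: for a collection of open sets
`I_i` these are the sets `I_{i,j}`. -/
def pieces (𝓤 : Set (Set M)) : Set (Set M) := {K | ∃ U ∈ 𝓤, K ∈ components U}

variable {G : Type*} [Group G]

/-- `g` maps the set `K` onto itself. -/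
def Stabilizes (φ : G →* HomeoPlus M) (K : Set M) (g : G) : Prop := (φ g : M ≃ₜ M) '' K = K

/-- `𝓘` (the collection of the sets `I_i`) and `𝓜` (the collection of the sets `M_i`) form an
interval decomposition for the action `φ`. -/
structure IsIntervalDecomposition (φ : G →* HomeoPlus M) (𝓘 𝓜 : Set (Set M)) : Prop where
  countable : (𝓘 ∪ 𝓜).Countable
  isOpen : ∀ U ∈ 𝓘 ∪ 𝓜, IsOpen U
  nonempty : ∀ U ∈ 𝓘 ∪ 𝓜, U.Nonempty
  disjoint_I : ∀ U ∈ 𝓘, ∀ V ∈ 𝓘, U ≠ V → Disjoint U V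
  disjoint_M : ∀ U ∈ 𝓜, ∀ V ∈ 𝓜, U ≠ V → Disjoint U V
  disjoint_I_M : ∀ U ∈ 𝓘, ∀ V ∈ 𝓜, Disjoint U V
  invariant : ∀ U ∈ 𝓘 ∪ 𝓜, ∀ g : G, Stabilizes φ U g
  /-- Each `I_i` is a union of open intervals `I_{i,j}`. -/
  interval_I : ∀ U ∈ 𝓘, ∀ K ∈ components U, IsOpenInterval K
  transitive : ∀ U ∈ 𝓘, ∀ K ∈ components U, ∀ K' ∈ components U,
    ∃ g : G, (φ g : M ≃ₜ M) '' K = K'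
  trivial : ∀ U ∈ 𝓘, ∀ K ∈ components U, ∀ g : G, Stabilizes φ K g →
    ∀ x ∈ K, (φ g : M ≃ₜ M) x = x
  /-- Each `M_i` is a union of open intervals `M_{i,j}`, or it is the whole circle. -/
  interval_M : ∀ V ∈ 𝓜, (∀ K ∈ components V, IsOpenInterval K) ∨
    (V = Set.univ ∧ Nonempty (M ≃ₜ UnitAddCircle))
  /-- Every orbit in `M_i` is dense in `M_i`. -/
  minimal : ∀ V ∈ 𝓜, ∀ x ∈ V, V ⊆ closure {y | ∃ g : G, (φ g : M ≃ₜ M) x = y}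
  /-- The stabilizer of each `M_{i,j}` acts on it as an abelian group (if `M_i` is the whole circle
  then the whole group acts as an abelian group). -/
  abelian : ∀ V ∈ 𝓜, ∀ K ∈ components V, ∀ g h : G, Stabilizes φ K g → Stabilizes φ K h →
    ∀ x ∈ K, (φ g : M ≃ₜ M) ((φ h : M ≃ₜ M) x) = (φ h : M ≃ₜ M) ((φ g : M ≃ₜ M) x)
  dense : Dense (⋃₀ 𝓘 ∪ ⋃₀ 𝓜)

/-- Topological conjugacy of actions. -/
def Conjugate (φ ψ : G →* HomeoPlus M) : Prop :=
  ∃ h : M ≃ₜ M, ∀ (g : G) (x : M), h ((φ g : M ≃ₜ M) x) = (ψ g : M ≃ₜ M) (h x)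

/-- The homeomorphism `h` sends the intervals `I_{i,j}`, `M_{i,j}` of `φ` onto those of `ψ` and
intertwines the two actions on these intervals. -/
structure Carries (h : M ≃ₜ M) (φ ψ : G →* HomeoPlus M) (𝓘 𝓜 𝓘' 𝓜' : Set (Set M)) : Prop where
  image_I : (fun K : Set M => h '' K) '' pieces 𝓘 = pieces 𝓘'
  image_M : (fun K : Set M => h '' K) '' pieces 𝓜 = pieces 𝓜'
  intertwines : ∀ K ∈ pieces 𝓘 ∪ pieces 𝓜, ∀ x ∈ K, ∀ g : G,
    h ((φ g : M ≃ₜ M) x) = (ψ g : M ≃ₜ M) (h x)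

/-- In the coordinate `p` on `K`, each `g` that stabilizes `K` acts on `K` as the translation of
the line by `τ g`. -/
def ActsByTranslations (φ : G →* HomeoPlus M) (K : Set M) (p : K ≃ₜ ℝ) (τ : G → ℝ) : Prop :=
  ∀ g : G, Stabilizes φ K g → ∀ x y : K, (y : M) = (φ g : M ≃ₜ M) x → p y = p x + τ g

end

end OneDimAction

/-!
Both characterizations of conjugacy rest on two facts. A homeomorphism that carries one
decomposition to another intertwines the actions on a dense set, hence everywhere
(`Carries.conjugate`), and a conjugacy transports any decomposition of the first action to one of
the second (`IsIntervalDecomposition.image`). What remains of the first part is the existence of an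
interval decomposition (`exists_isIntervalDecomposition`).

By Zorn's lemma, a decomposition exists once every nonempty invariant open set contains a set that
satisfies the conditions on an `I_i` or on an `M_i`. Such a set is the union of the translates of
an interval `J` that is either *wandering* (an element that does not move `J` off itself is the
identity on `J`) or a *minimal block* (the translates of `J` are equal to `J` or disjoint from it,
the orbits are dense in `J`, and the stabilizer acts on `J` as an abelian group). To find `J`, one
passes to an action on the line: an action on a line or an interval is extended by the identity,
and an action on the circle is replaced by the group of its lifts, which is a central extension
by the integers.

For a finitely generated nilpotent group acting on the line, `J` is found by induction on the Hirsch
length (`exists_wandering_or_minimalBlock_of_isNilpotent`). On an interval without global fixed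
points, finite generation yields a minimal closed invariant set `C`. The group acts on `C` through
an abelian quotient (`IsMinimalIn.smul_comm_of_isNilpotent`): otherwise some commutator
`z = ⁅g, h⁆` would be central in the quotient, without fixed points in `C` and with cofinal orbits,
and then `⁅g ^ n, h ^ n⁆ = z ^ (n * n)` would move a point too far
(`false_of_cofinal_central_commutator`). If `C` is the whole interval, it is a minimal block. If
not, the stabilizer of a complementary interval fixes `C` pointwise, so it lies in the kernel of
the action on `C`, whose Hirsch length is smaller
(`HirschLengthLE.exists_lt_of_normal`). In a virtually nilpotent group, `J` is found first for a
normal nilpotent subgroup of finite index. If it is wandering, it is then shrunk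
(`IsWanderingSet.exists_of_finiteIndex`); if it is a minimal block, it is one for the whole group
(`IsMinimalBlock.of_finiteIndex`).

By Hölder's theorem, an abelian group acting on an interval with dense orbits acts by translations
in a suitable coordinate (`exists_homeomorph_translation`). A continuous map that conjugates a
dense set of translations to translations is affine (`eq_affine_of_dense_translations`); its slope
is the constant `c` that relates the translation numbers.
-/

namespace OneDimAction

universe u v

open scoped commutatorElement Pointwise

/-! ### Groups of bounded Hirsch length -/

/-- A group is of Hirsch length at most `n` if it can be reduced to a finite group by `n` steps,
each of which passes to a subgroup of finite index and then to the kernel of a homomorphism to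
the integers. Such groups are exactly the polycyclic-by-finite ones with at most `n` infinite
cyclic factors. -/
def HirschLengthLE : ℕ → ∀ (G : Type u) [Group G], Prop
  | 0, G, _ => Finite G
  | n + 1, G, _ => ∃ H : Subgroup G, H.FiniteIndex ∧
      ∃ f : H →* Multiplicative ℤ, HirschLengthLE n f.ker

theorem finiteIndex_comap {G : Type u} {G' : Type v} [Group G] [Group G'] (i : G →* G')
    (H : Subgroup G') [H.FiniteIndex] : (H.comap i).FiniteIndex := by
  rw [Subgroup.finiteIndex_iff, Subgroup.index_comap]
  exact fun h => (Subgroup.finiteIndex_iff.mp inferInstance :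
    H.index ≠ 0) (Subgroup.index_eq_zero_of_relIndex_eq_zero h)

theorem finite_of_finiteIndex {G : Type u} [Group G] (H : Subgroup G) [H.FiniteIndex] [Finite H] :
    Finite G := by
  have h : Nat.card G ≠ 0 := by
    rw [← H.card_mul_index]
    exact mul_ne_zero Nat.card_pos.ne' Subgroup.FiniteIndex.index_ne_zero
  exact Nat.finite_of_card_ne_zero h

/-- The map induced by `i` from the kernel of `f ∘ i` to the kernel of `f`. -/
def kerMap {G : Type u} {G' : Type v} [Group G] [Group G'] {A : Type*} [Group A] (i : G →* G')
    (f : G' →* A) : (f.comp i).ker →* f.ker :=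
  (i.comp (f.comp i).ker.subtype).codRestrict f.ker fun x => x.2

theorem HirschLengthLE.of_injective {n : ℕ} : ∀ {G : Type u} {G' : Type v} [Group G] [Group G']
    (i : G →* G'), Function.Injective i → HirschLengthLE n G' → HirschLengthLE n G := by
  induction n with
  | zero =>
    intro G G' _ _ i hi h
    have : Finite G' := h
    exact Finite.of_injective i hi
  | succ n ih =>
    rintro G G' _ _ i hi ⟨H, hH, f, hf⟩
    refine ⟨H.comap i, finiteIndex_comap i H, f.comp (i.subgroupComap H), ?_⟩
    refine ih (kerMap (i.subgroupComap H) f) (fun x y hxy => ?_) hf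
    have h := congrArg (fun z : f.ker => ((z : H) : G')) hxy
    exact Subtype.ext (Subtype.ext (hi h))

theorem HirschLengthLE.subgroup {n : ℕ} {G : Type u} [Group G] (h : HirschLengthLE n G)
    (H : Subgroup G) : HirschLengthLE n H :=
  .of_injective H.subtype H.subtype_injective h

theorem HirschLengthLE.of_le {n : ℕ} {G : Type u} [Group G] {H K : Subgroup G} (hHK : H ≤ K)
    (h : HirschLengthLE n K) : HirschLengthLE n H :=
  .of_injective (Subgroup.inclusion hHK) (Subgroup.inclusion_injective hHK) h

theorem HirschLengthLE.of_finiteIndex {n : ℕ} {G : Type u} [Group G] (H : Subgroup G)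
    [H.FiniteIndex] (h : HirschLengthLE n H) : HirschLengthLE n G := by
  cases n with
  | zero =>
    have : Finite H := h
    exact finite_of_finiteIndex H
  | succ n =>
    obtain ⟨K, hK, f, hf⟩ := h
    have e : K ≃* K.map H.subtype := K.equivMapOfInjective _ H.subtype_injective
    refine ⟨K.map H.subtype, ?_, f.comp e.symm.toMonoidHom, ?_⟩
    · rw [Subgroup.finiteIndex_iff, Subgroup.index_map_subtype]
      exact mul_ne_zero hK.index_ne_zero Subgroup.FiniteIndex.index_ne_zero
    · refine .of_injective (kerMap e.symm.toMonoidHom f) (fun x y hxy => ?_) hf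
      have h := congrArg (fun z : f.ker => (z : K)) hxy
      exact Subtype.ext (e.symm.injective h)

theorem HirschLengthLE.of_extension {m n : ℕ} : ∀ {G : Type u} {Q : Type v} [Group G] [Group Q]
    (p : G →* Q), HirschLengthLE m p.ker → HirschLengthLE n Q → HirschLengthLE (m + n) G := by
  induction n with
  | zero =>
    intro G Q _ _ p hm hn
    have : Finite Q := hn
    exact .of_finiteIndex p.ker hm
  | succ n ih =>
    rintro G Q _ _ p hm ⟨H, hH, f, hf⟩
    refine ⟨H.comap p, finiteIndex_comap p H, f.comp (p.subgroupComap H), ?_⟩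
    refine ih (kerMap (p.subgroupComap H) f) ?_ hf
    refine .of_injective (G' := p.ker)
      (((H.comap p).subtype.comp ((f.comp (p.subgroupComap H)).ker.subtype.comp
        (kerMap (p.subgroupComap H) f).ker.subtype)).codRestrict p.ker ?_) ?_ hm
    · intro x
      have h := congrArg (fun z : f.ker => ((z : H) : Q)) x.2
      exact h
    · intro x y hxy
      have h := congrArg (fun z : p.ker => (z : G)) hxy
      exact Subtype.ext (Subtype.ext (Subtype.ext h))

/-- In particular, all subgroups of a group of finite Hirsch length are finitely generated. -/
theorem HirschLengthLE.fg {n : ℕ} : ∀ {G : Type u} [Group G], HirschLengthLE n G →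
    Group.FG G := by
  induction n with
  | zero =>
    intro G _ h
    have : Finite G := h
    infer_instance
  | succ n ih =>
    rintro G _ ⟨H, hH, f, hf⟩
    have hker : (f.ker).FG := (Group.fg_iff_subgroup_fg _).mp (ih hf)
    obtain ⟨t, ht⟩ : ∃ t : H, f.range ≤ Subgroup.zpowers (f t) := by
      obtain ⟨⟨b, t, rfl⟩, hb⟩ := IsCyclic.exists_generator (α := f.range)
      refine ⟨t, fun x hx => ?_⟩
      obtain ⟨k, hk⟩ := hb ⟨x, hx⟩
      exact ⟨k, congrArg (fun z : f.range => (z : Multiplicative ℤ)) hk⟩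
    have h1 : (⊤ : Subgroup H) = f.ker ⊔ Subgroup.zpowers t := by
      refine (eq_top_iff.mpr fun x _ => ?_).symm
      obtain ⟨k, hk⟩ := ht ⟨x, rfl⟩
      have hx : x = x * (t ^ k)⁻¹ * t ^ k := by group
      rw [hx]
      refine Subgroup.mul_mem_sup ?_ ⟨k, rfl⟩
      have hk' : f t ^ k = f x := hk
      rw [MonoidHom.mem_ker, map_mul, map_inv, map_zpow, hk', mul_inv_cancel]
    have h2 : Group.FG H := by
      rw [Group.fg_def, h1]
      exact hker.sup ⟨{t}, by rw [Finset.coe_singleton, Subgroup.zpowers_eq_closure]⟩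
    obtain ⟨T, hT, -⟩ := H.exists_isComplement_left 1
    have hTf : T.Finite := by
      have h3 := hT.encard_left
      exact Set.encard_ne_top_iff.mp (by rw [h3]; simp)
    have h3 : (⊤ : Subgroup G) = Subgroup.closure T ⊔ H := by
      refine (eq_top_iff.mpr fun x _ => ?_).symm
      obtain ⟨⟨a, b⟩, hab⟩ := hT.2 x
      rw [← hab]
      exact Subgroup.mul_mem_sup (Subgroup.subset_closure a.2) b.2
    rw [Group.fg_def, h3]
    exact Subgroup.FG.sup ⟨hTf.toFinset, by simp⟩ ((Group.fg_iff_subgroup_fg _).mp h2)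

theorem hirschLengthLE_one_of_isCyclic {G : Type u} [Group G] [IsCyclic G] :
    HirschLengthLE 1 G := by
  have key : ∀ f : G →* Multiplicative ℤ, Finite f.ker → HirschLengthLE 1 G := fun f hf =>
    ⟨⊤, inferInstance, f.comp (⊤ : Subgroup G).subtype,
      Finite.of_injective (kerMap (⊤ : Subgroup G).subtype f) fun x y hxy =>
        Subtype.ext (Subtype.ext (congrArg (fun z : f.ker => (z : G)) hxy))⟩
  cases finite_or_infinite G with
  | inl h => exact key 1 inferInstance
  | inr h =>
    refine key (intCyclicMulEquiv (G := G)).symm.toMonoidHom ?_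
    have : (intCyclicMulEquiv (G := G)).symm.toMonoidHom.ker = ⊥ :=
      (MonoidHom.ker_eq_bot_iff _).mpr (intCyclicMulEquiv (G := G)).symm.injective
    rw [this]
    infer_instance

theorem exists_hirschLengthLE_of_comm {G : Type u} [Group G] [Group.FG G]
    (hcomm : ∀ x y : G, x * y = y * x) : ∃ n, HirschLengthLE n G := by
  classical
  let _ : CommGroup G := { (inferInstance : Group G) with mul_comm := hcomm }
  have key : ∀ S : Finset G, ∃ n, HirschLengthLE n (Subgroup.closure (S : Set G)) := by
    intro S
    induction S using Finset.induction_on with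
    | empty =>
      refine ⟨0, ?_⟩
      rw [Finset.coe_empty, Subgroup.closure_empty]
      exact (inferInstance : Finite (⊥ : Subgroup G))
    | insert s S _ ih =>
      obtain ⟨n, hn⟩ := ih
      set A := Subgroup.closure (S : Set G)
      set B := Subgroup.closure ((insert s S : Finset G) : Set G) with hB
      let p : B →* G ⧸ A := (QuotientGroup.mk' A).comp B.subtype
      have hp : p.range ≤ Subgroup.zpowers (s : G ⧸ A) := by
        have h1 : p.range = B.map (QuotientGroup.mk' A) := by
          rw [MonoidHom.range_comp, Subgroup.range_subtype]
        rw [h1, Subgroup.map_le_iff_le_comap, hB, Subgroup.closure_le]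
        intro x hx
        rw [Finset.coe_insert] at hx
        rcases hx with rfl | hx
        · exact ⟨1, by simp⟩
        · have : (x : G ⧸ A) = 1 := (QuotientGroup.eq_one_iff x).mpr (Subgroup.subset_closure hx)
          refine ⟨0, ?_⟩
          simp [this]
      refine ⟨n + 1, .of_extension p.rangeRestrict ?_
        (.of_le hp hirschLengthLE_one_of_isCyclic)⟩
      rw [MonoidHom.ker_rangeRestrict]
      refine .of_injective ((B.subtype.comp p.ker.subtype).codRestrict A fun x => ?_)
        (fun x y hxy => ?_) hn
      · exact (QuotientGroup.eq_one_iff _).mp x.2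
      · exact Subtype.ext (Subtype.ext (congrArg (fun z : A => (z : G)) hxy))
  obtain ⟨S, hS⟩ := (Group.fg_def.mp ‹Group.FG G› : (⊤ : Subgroup G).FG)
  obtain ⟨n, hn⟩ := key S
  rw [hS] at hn
  exact ⟨n, .of_injective (Subgroup.topEquiv (G := G)).symm.toMonoidHom
    (Subgroup.topEquiv (G := G)).symm.injective hn⟩

/-- If a central subgroup `L` is generated by the commutators of `A ≥ L` with a finitely generated
group `G`, then finitely many commutators suffice as soon as `A` is finitely generated modulo
`L`: modulo a central subgroup, the commutator is multiplicative in each argument. -/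
theorem fg_of_eq_commutator {G : Type u} [Group G] [Group.FG G] (A L : Subgroup G) [L.Normal]
    (hLA : L ≤ A) (hcen : L ≤ Subgroup.center G) (hcomm : L = ⁅A, (⊤ : Subgroup G)⁆)
    (hA : (A.map (QuotientGroup.mk' L)).FG) : L.FG := by
  classical
  obtain ⟨T₀, hT₀⟩ := hA
  obtain ⟨S, hS⟩ := (Group.fg_def.mp ‹Group.FG G› : (⊤ : Subgroup G).FG)
  set T : Finset G := T₀.image Quotient.out
  have hTA : ∀ t ∈ T, t ∈ A := by
    intro t ht
    obtain ⟨t₀, ht₀, rfl⟩ := Finset.mem_image.mp ht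
    have h1 : t₀ ∈ A.map (QuotientGroup.mk' L) := by
      rw [← hT₀]; exact Subgroup.subset_closure ht₀
    obtain ⟨a, ha, rfl⟩ := h1
    have h2 : ((Quotient.out (a : G ⧸ L) : G) : G ⧸ L) = (a : G ⧸ L) := QuotientGroup.out_eq' _
    have h3 := hLA (QuotientGroup.eq.mp h2.symm)
    have h4 := A.mul_mem ha h3
    rwa [mul_inv_cancel_left] at h4
  set M : Subgroup G := Subgroup.closure (Set.image2 (fun t s => ⁅t, s⁆) (T : Set G) (S : Set G))
    with hM
  have hML : M ≤ L := by
    rw [hM, Subgroup.closure_le]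
    rintro _ ⟨t, ht, s, -, rfl⟩
    rw [hcomm]
    exact Subgroup.commutator_mem_commutator (hTA t ht) (Subgroup.mem_top s)
  have hMn : M.Normal := ⟨fun m hm g => by
    have h := Subgroup.mem_center_iff.mp (hcen (hML hm)) g
    rwa [h, mul_inv_cancel_right]⟩
  have h1 : ∀ s ∈ S, ∀ a ∈ A, (a : G ⧸ M) * s = s * a := by
    intro s hs
    have hAT : A ≤ Subgroup.closure (T : Set G) ⊔ L := by
      intro a ha
      have h2 : QuotientGroup.mk' L a ∈
          (Subgroup.closure (T : Set G)).map (QuotientGroup.mk' L) := by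
        have h3 : QuotientGroup.mk' L '' (T : Set G) = T₀ := by
          ext x
          simp only [T, Finset.coe_image, Set.mem_image, exists_exists_and_eq_and]
          constructor
          · rintro ⟨y, hy, rfl⟩
            have h2 : ((Quotient.out y : G) : G ⧸ L) = y := QuotientGroup.out_eq' _
            rw [QuotientGroup.mk'_apply, h2]
            exact hy
          · intro hx
            exact ⟨x, hx, QuotientGroup.out_eq' _⟩
        rw [MonoidHom.map_closure, h3, hT₀]
        exact ⟨a, ha, rfl⟩
      obtain ⟨c, hc, hca⟩ := h2
      have h4 : c⁻¹ * a ∈ L := QuotientGroup.eq.mp hca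
      have h5 := Subgroup.mul_mem_sup hc h4
      rwa [mul_inv_cancel_left] at h5
    have h6 : Subgroup.closure (T : Set G) ⊔ L ≤
        (Subgroup.centralizer {(s : G ⧸ M)}).comap (QuotientGroup.mk' M) := by
      rw [sup_le_iff, Subgroup.closure_le]
      constructor
      · intro t ht
        simp only [Subgroup.coe_comap, Set.mem_preimage, QuotientGroup.mk'_apply, SetLike.mem_coe,
          Subgroup.mem_centralizer_singleton_iff]
        have h7 : ⁅t, s⁆ ∈ M := Subgroup.subset_closure ⟨t, ht, s, hs, rfl⟩
        have h8 := (QuotientGroup.eq_one_iff (N := M) _).mpr h7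
        have h9 : ⁅(t : G ⧸ M), (s : G ⧸ M)⁆ = 1 := h8
        exact commutatorElement_eq_one_iff_mul_comm.mp h9
      · intro l hl
        simp only [Subgroup.mem_comap, QuotientGroup.mk'_apply,
          Subgroup.mem_centralizer_singleton_iff]
        rw [← QuotientGroup.mk_mul, ← QuotientGroup.mk_mul,
          Subgroup.mem_center_iff.mp (hcen hl) s]
    intro a ha
    exact Subgroup.mem_centralizer_singleton_iff.mp (h6 (hAT ha))
  have h2 : ∀ a ∈ A, ∀ g : G, ⁅a, g⁆ ∈ M := by
    intro a ha g
    have h3 : Subgroup.closure (S : Set G) ≤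
        (Subgroup.centralizer {(a : G ⧸ M)}).comap (QuotientGroup.mk' M) := by
      rw [Subgroup.closure_le]
      intro s hs
      exact Subgroup.mem_centralizer_singleton_iff.mpr (h1 s hs a ha).symm
    rw [hS] at h3
    have h4 := Subgroup.mem_centralizer_singleton_iff.mp (h3 (Subgroup.mem_top g))
    rw [← QuotientGroup.eq_one_iff]
    exact commutatorElement_eq_one_iff_mul_comm.mpr h4.symm
  have h3 : L = M := by
    refine le_antisymm ?_ hML
    rw [hcomm, Subgroup.commutator_le]
    exact fun a ha g _ => h2 a ha g
  rw [h3]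
  exact ⟨(T ×ˢ S).image fun p => ⁅p.1, p.2⁆, by
    rw [hM]; congr 1; ext x; simp [Set.mem_image2]⟩

/-- The proof is by induction on the nilpotency class: the last nontrivial term of the lower central
series is central, and it is finitely generated because it is generated by commutators with the
preceding term, which is finitely generated modulo the last one. -/
theorem exists_hirschLengthLE_of_isNilpotent (G : Type u) [Group G] [Group.FG G]
    [Group.IsNilpotent G] : ∃ n, HirschLengthLE n G := by
  have key : ∀ (c : ℕ) (G : Type u) [Group G] [Group.FG G],
      (⊤ : Subgroup G).lowerCentralSeries c = ⊥ → ∃ n, HirschLengthLE n G := by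
    intro c
    induction c with
    | zero =>
      intro G _ _ h
      have h1 : (⊤ : Subgroup G) = ⊥ := h
      have : Subsingleton G := Subgroup.subsingleton_iff.mp (subsingleton_of_bot_eq_top h1.symm)
      exact ⟨0, (inferInstance : Finite G)⟩
    | succ c ih =>
      intro G _ _ h
      set L := (⊤ : Subgroup G).lowerCentralSeries c with hL
      have hcen : L ≤ Subgroup.center G := by
        intro x hx
        rw [Subgroup.mem_center_iff]
        intro g
        have h1 : ⁅x, g⁆ ∈ (⊤ : Subgroup G).lowerCentralSeries (c + 1) := by
          rw [Subgroup.lowerCentralSeries_succ]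
          exact Subgroup.commutator_mem_commutator hx (Subgroup.mem_top g)
        rw [h, Subgroup.mem_bot] at h1
        exact (commutatorElement_eq_one_iff_mul_comm.mp h1).symm
      have hLn : L.Normal := ⟨fun m hm g => by
        have h := Subgroup.mem_center_iff.mp (hcen hm) g
        rwa [h, mul_inv_cancel_right]⟩
      obtain ⟨k, hk⟩ := ih (G ⧸ L) (by
        have h1 := Subgroup.map_lowerCentralSeries (⊤ : Subgroup G) (QuotientGroup.mk' L) c
        rw [Subgroup.map_top_of_surjective _ (QuotientGroup.mk'_surjective L)] at h1
        rw [← h1, ← hL, QuotientGroup.map_mk'_self])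
      have hLfg : L.FG := by
        cases c with
        | zero => exact Group.fg_def.mp ‹Group.FG G›
        | succ c =>
          refine fg_of_eq_commutator ((⊤ : Subgroup G).lowerCentralSeries c) L
            (Subgroup.lowerCentralSeries_antitone _ (Nat.le_succ c)) hcen
            (Subgroup.lowerCentralSeries_succ _ _) ?_
          exact (Group.fg_iff_subgroup_fg _).mp (hk.subgroup _).fg
      have := (Group.fg_iff_subgroup_fg _).mpr hLfg
      obtain ⟨m, hm⟩ := exists_hirschLengthLE_of_comm (G := L) fun x y =>
        Subtype.ext (Subgroup.mem_center_iff.mp (hcen y.2) x)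
      refine ⟨m + k, .of_extension (QuotientGroup.mk' L) ?_ hk⟩
      rwa [QuotientGroup.ker_mk']
  obtain ⟨c, hc⟩ := Subgroup.nilpotent_iff_lowerCentralSeries.mp ‹Group.IsNilpotent G›
  exact key c G hc

/-- The Hirsch length drops when one passes to a normal subgroup `N` whose quotient has an element
of infinite order. -/
theorem HirschLengthLE.exists_lt_of_normal {n : ℕ} : ∀ {G : Type u} [Group G], HirschLengthLE n G →
    ∀ (N : Subgroup G), N.Normal → ∀ g : G, (∀ k : ℕ, 0 < k → g ^ k ∉ N) →
    ∃ m < n, HirschLengthLE m N := by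
  induction n with
  | zero =>
    intro G _ h N _ g hg
    have : Finite G := h
    exact absurd (by rw [pow_orderOf_eq_one]; exact N.one_mem) (hg _ (orderOf_pos g))
  | succ n ih =>
    rintro G _ ⟨H, hH, f, hf⟩ N hN g hg
    -- the subgroups `N ∩ H` and `N ∩ ker f`, seen inside `N` and inside `ker f`
    have hN1 : (H.subgroupOf N).FiniteIndex := inferInstance
    let i : H.subgroupOf N →* H :=
      (N.subtype.comp (H.subgroupOf N).subtype).codRestrict H fun x => x.2
    have hi : Function.Injective i := fun x y hxy =>
      Subtype.ext (Subtype.ext (congrArg (fun z : H => (z : G)) hxy))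
    let j : f.ker →* G := H.subtype.comp f.ker.subtype
    by_cases hl : ∃ l : f.ker, ∀ k : ℕ, 0 < k → l ^ k ∉ N.comap j
    · obtain ⟨l, hl⟩ := hl
      obtain ⟨m, hmn, hm⟩ := ih hf (N.comap j) inferInstance l hl
      refine ⟨m + 1, by omega, H.subgroupOf N, hN1, f.comp i, ?_⟩
      refine .of_injective ((kerMap i f).codRestrict (N.comap j) fun x => ?_)
        (fun x y hxy => ?_) hm
      · exact x.1.1.2
      · have h := congrArg (fun z : N.comap j => ((z : f.ker) : H)) hxy
        exact Subtype.ext (hi h)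
    · push Not at hl
      refine ⟨n, by omega, .of_finiteIndex (H.subgroupOf N) ?_⟩
      suffices hsub : ∀ x : H.subgroupOf N, f (i x) = 1 from
        .of_injective (i.codRestrict f.ker hsub)
          (fun x y hxy => hi (congrArg (fun z : f.ker => (z : H)) hxy)) hf
      intro x
      by_contra hx
      obtain ⟨r, hr0, -, hr⟩ := Subgroup.exists_pow_mem_of_index_ne_zero hH.index_ne_zero g
      -- with `a = f (g ^ r)` and `b = f x ≠ 0`, the element `(g ^ r) ^ b * x ^ (-a)` is in `ker f`
      obtain ⟨b, hb⟩ : ∃ b : ℤ, f (i x) = Multiplicative.ofAdd b := ⟨_, rfl⟩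
      obtain ⟨a, ha⟩ : ∃ a : ℤ, f ⟨g ^ r, hr⟩ = Multiplicative.ofAdd a := ⟨_, rfl⟩
      have hb0 : b ≠ 0 := by rintro rfl; exact hx hb
      let y : H := ⟨g ^ r, hr⟩ ^ b * (i x) ^ (-a)
      have hy : f y = 1 := by
        simp only [y, map_mul, map_zpow, ha, hb, ← ofAdd_zsmul, ← ofAdd_add]
        simp [mul_comm]
      obtain ⟨k, hk0, hk⟩ := hl ⟨y, hy⟩
      have h1 : ((g ^ r) ^ b * ((x : N) : G) ^ (-a)) ^ k ∈ N := hk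
      have h2 : ((((g ^ r) ^ b * ((x : N) : G) ^ (-a)) ^ k : G) : G ⧸ N) = 1 :=
        (QuotientGroup.eq_one_iff _).mpr h1
      have h3 : (((x : N) : G) : G ⧸ N) = 1 := (QuotientGroup.eq_one_iff _).mpr x.1.2
      rw [QuotientGroup.mk_pow, QuotientGroup.mk_mul, QuotientGroup.mk_zpow,
        QuotientGroup.mk_zpow, h3, one_zpow, mul_one, ← QuotientGroup.mk_zpow,
        ← QuotientGroup.mk_pow, QuotientGroup.eq_one_iff] at h2
      refine hg (r * b.natAbs * k) (by positivity) ?_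
      rw [pow_mul, pow_mul]
      rcases Int.natAbs_eq b with hb' | hb'
      · rw [hb', zpow_natCast] at h2
        exact h2
      · rw [hb', zpow_neg, zpow_natCast, inv_pow] at h2
        exact N.inv_mem_iff.mp h2

theorem exists_hirschLengthLE_of_isVirtuallyNilpotent {G : Type u} [Group G] [Group.FG G]
    (hG : Group.IsVirtuallyNilpotent G) : ∃ n, HirschLengthLE n G := by
  obtain ⟨N, hN, hfi⟩ := hG
  have := Subgroup.fg_of_index_ne_zero N
  obtain ⟨n, hn⟩ := exists_hirschLengthLE_of_isNilpotent N
  exact ⟨n, .of_finiteIndex N hn⟩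

/-! ### Monotone actions on the line -/

/-- Every group element acts as a monotone map. -/
class IsMonotoneAction (Γ X : Type*) [SMul Γ X] [Preorder X] : Prop where
  smul_le_smul : ∀ (g : Γ) {x y : X}, x ≤ y → g • x ≤ g • y

section order

variable {Γ X : Type*} [Group Γ] [LinearOrder X] [MulAction Γ X] [IsMonotoneAction Γ X]

instance IsMonotoneAction.subgroup (H : Subgroup Γ) : IsMonotoneAction H X :=
  ⟨fun g _ _ h => IsMonotoneAction.smul_le_smul (g : Γ) h⟩

theorem smul_le_smul_iff_of_monotone (g : Γ) {x y : X} : g • x ≤ g • y ↔ x ≤ y :=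
  ⟨fun h => by simpa using IsMonotoneAction.smul_le_smul g⁻¹ h,
    IsMonotoneAction.smul_le_smul g⟩

theorem smul_lt_smul_iff_of_monotone (g : Γ) {x y : X} : g • x < g • y ↔ x < y := by
  rw [← not_le, ← not_le, smul_le_smul_iff_of_monotone]

theorem inv_smul_le_iff_of_monotone (g : Γ) {x y : X} : g⁻¹ • x ≤ y ↔ x ≤ g • y := by
  rw [← smul_le_smul_iff_of_monotone g, smul_inv_smul]

theorem le_inv_smul_iff_of_monotone (g : Γ) {x y : X} : x ≤ g⁻¹ • y ↔ g • x ≤ y := by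
  rw [← smul_le_smul_iff_of_monotone g, smul_inv_smul]

instance [TopologicalSpace X] [OrderTopology X] : ContinuousConstSMul Γ X where
  continuous_const_smul g :=
    OrderIso.continuous ⟨MulAction.toPerm g, smul_le_smul_iff_of_monotone g⟩

/-- A monotone map has no periodic points other than its fixed points. -/
theorem pow_smul_eq_self_imp {g : Γ} {x : X} {n : ℕ} (hn : 0 < n) (h : g ^ n • x = x) :
    g • x = x := by
  rcases lt_trichotomy (g • x) x with hx | hx | hx
  · have : ∀ k : ℕ, g ^ (k + 1) • x < x := by
      intro k
      induction k with
      | zero => simpa using hx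
      | succ k ih =>
        rw [pow_succ', mul_smul]
        exact ((smul_lt_smul_iff_of_monotone g).mpr ih).trans hx
    obtain ⟨k, rfl⟩ := Nat.exists_eq_succ_of_ne_zero hn.ne'
    exact absurd h (this k).ne
  · exact hx
  · have : ∀ k : ℕ, x < g ^ (k + 1) • x := by
      intro k
      induction k with
      | zero => simpa using hx
      | succ k ih =>
        rw [pow_succ', mul_smul]
        exact hx.trans ((smul_lt_smul_iff_of_monotone g).mpr ih)
    obtain ⟨k, rfl⟩ := Nat.exists_eq_succ_of_ne_zero hn.ne'
    exact absurd h (this k).ne'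

/-- Two elements whose commutator `z` commutes with the whole group cannot act on a linearly
ordered set in such a way that `z` moves points up and the `z`-orbit of `x` is cofinal: the
commutator of the `n`-th powers is `z ^ (n * n)`, yet each of the four factors moves `x` by at most
a fixed multiple of `n` powers of `z`. -/
theorem false_of_cofinal_central_commutator (g h z : Γ)
    (hz : ∀ (k : Γ) (y : X), z • k • y = k • z • y) (hgh : ∀ y : X, g • h • y = z • h • g • y)
    (hpos : ∀ y : X, y < z • y) (x : X) (hcof : ∀ y : X, ∃ n : ℕ, y ≤ z ^ n • x) : False := by
  have hzn : ∀ (n : ℕ) (k : Γ) (y : X), z ^ n • k • y = k • z ^ n • y := by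
    intro n k
    induction n with
    | zero => simp
    | succ n ih => intro y; rw [pow_succ, mul_smul, hz, ih, mul_smul]
  have hstrict : StrictMono fun n : ℕ => z ^ n • x := by
    refine strictMono_nat_of_lt_succ fun n => ?_
    rw [pow_succ', mul_smul]
    exact hpos _
  have h1 : ∀ (n : ℕ) (y : X), g • h ^ n • y = z ^ n • h ^ n • g • y := by
    intro n
    induction n with
    | zero => simp
    | succ n ih =>
      intro y
      rw [pow_succ, mul_smul, ih, hgh, pow_succ, mul_smul, mul_smul, ← hz (h ^ n)]
  have h2 : ∀ (m n : ℕ) (y : X), g ^ m • h ^ n • y = z ^ (m * n) • h ^ n • g ^ m • y := by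
    intro m n
    induction m with
    | zero => simp
    | succ m ih =>
      intro y
      rw [pow_succ, mul_smul, h1, ← hzn, ih, mul_smul, ← mul_smul (z ^ n), ← pow_add]
      congr 2
      ring
  obtain ⟨k, hk⟩ : ∃ k : ℕ, ∀ u ∈ ({g, g⁻¹, h, h⁻¹} : Set Γ), u • x ≤ z ^ k • x := by
    obtain ⟨a, ha⟩ := hcof (g • x)
    obtain ⟨b, hb⟩ := hcof (g⁻¹ • x)
    obtain ⟨c, hc⟩ := hcof (h • x)
    obtain ⟨d, hd⟩ := hcof (h⁻¹ • x)
    refine ⟨a + b + c + d, ?_⟩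
    rintro u (rfl | rfl | rfl | rfl)
    · exact ha.trans (hstrict.monotone (by omega))
    · exact hb.trans (hstrict.monotone (by omega))
    · exact hc.trans (hstrict.monotone (by omega))
    · exact hd.trans (hstrict.monotone (by omega))
  have h3 : ∀ u ∈ ({g, g⁻¹, h, h⁻¹} : Set Γ), ∀ (n a : ℕ) (w : X), w ≤ z ^ a • x →
      u ^ n • w ≤ z ^ (a + k * n) • x := by
    intro u hu n a
    induction n with
    | zero => simp
    | succ n ih =>
      intro w hw
      rw [pow_succ', mul_smul]
      refine (IsMonotoneAction.smul_le_smul u (ih w hw)).trans ?_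
      rw [← hzn, mul_add, mul_one, ← add_assoc, pow_add z (a + k * n), mul_smul]
      exact IsMonotoneAction.smul_le_smul _ (hk u hu)
  set n := 4 * k + 1 with hn
  have h4 : z ^ (n * n) • x = g ^ n • h ^ n • g⁻¹ ^ n • h⁻¹ ^ n • x := by
    rw [h2]
    simp
  have h5 : z ^ (n * n) • x ≤ z ^ (0 + k * n + k * n + k * n + k * n) • x := by
    rw [h4]
    exact h3 g (by simp) _ _ _ (h3 h (by simp) _ _ _ (h3 g⁻¹ (by simp) _ _ _
      (h3 h⁻¹ (by simp) _ _ _ (by simp))))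
  have h6 := hstrict.le_iff_le.mp h5
  have h7 : 0 + k * n + k * n + k * n + k * n = 4 * k * n := by ring
  rw [h7] at h6
  have h8 := Nat.le_of_mul_le_mul_right h6 (by omega)
  omega

end order

section fixedPoints

variable {Γ : Type*} [Group Γ] [MulAction Γ ℝ]

variable (Γ) in
/-- `C` is an invariant subset of `K` that is closed relative to `K`. -/
structure IsInvariantClosedIn (K C : Set ℝ) : Prop where
  subset : C ⊆ K
  isOpen_diff : IsOpen (K \ C)
  smul_mem : ∀ (g : Γ), ∀ x ∈ C, g • x ∈ C

variable (Γ) in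
/-- `C` is minimal among the nonempty invariant subsets of `K` that are closed relative to `K`. -/
structure IsMinimalIn (K C : Set ℝ) : Prop extends IsInvariantClosedIn Γ K C where
  nonempty : C.Nonempty
  eq_of_subset : ∀ D ⊆ C, D.Nonempty → IsInvariantClosedIn Γ K D → D = C

theorem IsInvariantClosedIn.subgroup {K C : Set ℝ} (hC : IsInvariantClosedIn Γ K C)
    (H : Subgroup Γ) : IsInvariantClosedIn H K C :=
  ⟨hC.subset, hC.isOpen_diff, fun g => hC.smul_mem g⟩

theorem IsInvariantClosedIn.smul_mem_iff {K C : Set ℝ} (hC : IsInvariantClosedIn Γ K C) (g : Γ)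
    {x : ℝ} : g • x ∈ C ↔ x ∈ C :=
  ⟨fun h => by simpa using hC.smul_mem g⁻¹ _ h, hC.smul_mem g x⟩

variable [IsMonotoneAction Γ ℝ]

/-- The infimum of an orbit in `C` that is bounded below in `K` is a fixed point in `C`. -/
theorem exists_fixed_of_forall_le {K C : Set ℝ} (hK : K.OrdConnected)
    (hC : IsInvariantClosedIn Γ K C) {l w : ℝ} (hl : l ∈ C) (hw : w ∈ K)
    (h : ∀ g : Γ, w ≤ g • l) : ∃ p ∈ C, ∀ g : Γ, g • p = p := by
  set B := MulAction.orbit Γ l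
  have hBne : B.Nonempty := ⟨l, MulAction.mem_orbit_self l⟩
  have hlow : w ∈ lowerBounds B := by rintro _ ⟨g, rfl⟩; exact h g
  have hBbdd : BddBelow B := ⟨w, hlow⟩
  have hBC : B ⊆ C := by rintro _ ⟨g, rfl⟩; exact hC.smul_mem g l hl
  have hsK : sInf B ∈ K := hK.out hw (hC.subset hl)
    ⟨le_csInf hBne hlow, csInf_le hBbdd (MulAction.mem_orbit_self l)⟩
  have hle : ∀ g : Γ, g • sInf B ≤ sInf B := by
    intro g
    refine le_csInf hBne fun b hb => ?_
    rw [← le_inv_smul_iff_of_monotone]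
    exact csInf_le hBbdd (MulAction.mem_orbit_of_mem_orbit g⁻¹ hb)
  refine ⟨sInf B, ?_, fun g => le_antisymm (hle g) ?_⟩
  · by_contra hs
    obtain ⟨b, hb1, hb2⟩ := mem_closure_iff.mp (csInf_mem_closure hBne hBbdd) _ hC.isOpen_diff
      ⟨hsK, hs⟩
    exact hb1.2 (hBC hb2)
  · rw [← inv_smul_le_iff_of_monotone]
    exact hle g⁻¹

/-- The supremum of an orbit in `C` that is bounded above in `K` is a fixed point in `C`. -/
theorem exists_fixed_of_forall_ge {K C : Set ℝ} (hK : K.OrdConnected)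
    (hC : IsInvariantClosedIn Γ K C) {l w : ℝ} (hl : l ∈ C) (hw : w ∈ K)
    (h : ∀ g : Γ, g • l ≤ w) : ∃ p ∈ C, ∀ g : Γ, g • p = p := by
  set B := MulAction.orbit Γ l
  have hBne : B.Nonempty := ⟨l, MulAction.mem_orbit_self l⟩
  have hup : w ∈ upperBounds B := by rintro _ ⟨g, rfl⟩; exact h g
  have hBbdd : BddAbove B := ⟨w, hup⟩
  have hBC : B ⊆ C := by rintro _ ⟨g, rfl⟩; exact hC.smul_mem g l hl
  have hsK : sSup B ∈ K := hK.out (hC.subset hl) hw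
    ⟨le_csSup hBbdd (MulAction.mem_orbit_self l), csSup_le hBne hup⟩
  have hle : ∀ g : Γ, sSup B ≤ g • sSup B := by
    intro g
    refine csSup_le hBne fun b hb => ?_
    rw [← inv_smul_le_iff_of_monotone]
    exact le_csSup hBbdd (MulAction.mem_orbit_of_mem_orbit g⁻¹ hb)
  refine ⟨sSup B, ?_, fun g => le_antisymm ?_ (hle g)⟩
  · by_contra hs
    obtain ⟨b, hb1, hb2⟩ := mem_closure_iff.mp (csSup_mem_closure hBne hBbdd) _ hC.isOpen_diff
      ⟨hsK, hs⟩
    exact hb1.2 (hBC hb2)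
  · rw [← le_inv_smul_iff_of_monotone]
    exact hle g⁻¹

/-- For a finitely generated group without a global fixed point in an invariant interval, some
compact subinterval meets every orbit: it suffices that no generator jumps over it. -/
theorem exists_Icc_meets_orbits [Group.FG Γ] {K : Set ℝ} (hK : K.OrdConnected)
    (hKne : K.Nonempty) (hinv : ∀ (g : Γ), ∀ x ∈ K, g • x ∈ K)
    (hfix : ∀ x ∈ K, ∃ g : Γ, g • x ≠ x) :
    ∃ x ∈ K, ∃ y ∈ K, ∀ p ∈ K, ∃ g : Γ, g • p ∈ Set.Icc x y := by
  classical
  have hKK : IsInvariantClosedIn Γ K K := ⟨subset_rfl, by simp, hinv⟩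
  obtain ⟨x, hx⟩ := hKne
  obtain ⟨S, hS⟩ := (Group.fg_def.mp ‹Group.FG Γ› : (⊤ : Subgroup Γ).FG)
  set F : Finset ℝ := insert x ((S ∪ S.image fun s => s⁻¹).image fun s => s • x) with hF
  have hFne : F.Nonempty := ⟨x, Finset.mem_insert_self _ _⟩
  set y := F.max' hFne with hy
  have hyK : y ∈ K := by
    have h := F.max'_mem hFne
    rw [← hy] at h
    rcases Finset.mem_insert.mp h with h | h
    · rwa [h]
    · obtain ⟨s, -, hs⟩ := Finset.mem_image.mp h
      rw [← hs]
      exact hinv s x hx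
  have hgen : ∀ s ∈ S, s • x ≤ y ∧ s⁻¹ • x ≤ y := by
    intro s hs
    refine ⟨F.le_max' _ (Finset.mem_insert_of_mem (Finset.mem_image_of_mem _ ?_)),
      F.le_max' _ (Finset.mem_insert_of_mem (Finset.mem_image_of_mem _ ?_))⟩
    · exact Finset.mem_union_left _ hs
    · exact Finset.mem_union_right _ (Finset.mem_image_of_mem _ hs)
  refine ⟨x, hx, y, hyK, fun p hp => ?_⟩
  by_contra hcon
  push Not at hcon
  have hdich : ∀ g : Γ, g • p < x ∨ y < g • p := by
    intro g
    by_contra h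
    push Not at h
    exact hcon g h
  -- being to the left of `x` is preserved by the generators and their inverses
  have hstep : ∀ u : Γ, u • x ≤ y → ∀ g : Γ, g • p < x → (u * g) • p < x := by
    intro u hu g hg
    refine (hdich (u * g)).resolve_right fun h => ?_
    rw [mul_smul] at h
    exact absurd (h.trans ((smul_lt_smul_iff_of_monotone u).mpr hg)) (not_lt.mpr hu)
  have hall : ∀ u g : Γ, g • p < x ↔ (u * g) • p < x := by
    intro u
    have hu : u ∈ Subgroup.closure (S : Set Γ) := by rw [hS]; exact Subgroup.mem_top u
    induction hu using Subgroup.closure_induction with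
    | mem s hs =>
      intro g
      refine ⟨hstep s (hgen s hs).1 g, fun h => ?_⟩
      have := hstep s⁻¹ (hgen s hs).2 _ h
      rwa [inv_mul_cancel_left] at this
    | one => simp
    | mul a b _ _ ha hb =>
      intro g
      rw [mul_assoc, ← ha, ← hb]
    | inv a _ ha =>
      intro g
      rw [ha (a⁻¹ * g), mul_inv_cancel_left]
  rcases hdich 1 with h | h
  · obtain ⟨q, hq, hqf⟩ := exists_fixed_of_forall_ge hK hKK hp hx fun g => by
      have := (hall g 1).mp h
      rw [mul_one] at this
      exact this.le
    obtain ⟨g, hg⟩ := hfix q hq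
    exact hg (hqf g)
  · obtain ⟨q, hq, hqf⟩ := exists_fixed_of_forall_le hK hKK hp hyK fun g => by
      refine ((hdich g).resolve_left fun h' => ?_).le
      rw [← mul_one g, ← hall g 1] at h'
      exact absurd (h'.trans_le (F.le_max' x (Finset.mem_insert_self _ _))) h.not_gt
    obtain ⟨g, hg⟩ := hfix q hq
    exact hg (hqf g)

/-- Zorn's lemma applies because all the sets in question meet a fixed compact interval. -/
theorem exists_isMinimalIn [Group.FG Γ] {K : Set ℝ} (hK : K.OrdConnected) (hKne : K.Nonempty)
    (hinv : ∀ (g : Γ), ∀ x ∈ K, g • x ∈ K)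
    (hfix : ∀ x ∈ K, ∃ g : Γ, g • x ≠ x) : ∃ C, IsMinimalIn Γ K C := by
  obtain ⟨x, hx, y, hy, hxy⟩ := exists_Icc_meets_orbits hK hKne hinv hfix
  obtain ⟨C, hC⟩ := zorn_superset {C : Set ℝ | C.Nonempty ∧ IsInvariantClosedIn Γ K C} (by
    intro c hc hchain
    rcases c.eq_empty_or_nonempty with rfl | hcne
    · exact ⟨K, ⟨hKne, subset_rfl, by simp, hinv⟩, by simp⟩
    refine ⟨⋂₀ c, ⟨?_, ?_, ?_, ?_⟩, fun s hs => Set.sInter_subset_of_mem hs⟩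
    · have hne : (⋂ C : c, (C : Set ℝ) ∩ Set.Icc x y).Nonempty := by
        have := hcne.to_subtype
        have hcl : ∀ C : c, IsClosed ((C : Set ℝ) ∩ Set.Icc x y) := by
          intro C
          have : (C : Set ℝ) ∩ Set.Icc x y = Set.Icc x y \ (K \ C) := by
            ext t
            constructor
            · rintro ⟨h1, h2⟩
              exact ⟨h2, fun h => h.2 h1⟩
            · rintro ⟨h1, h2⟩
              refine ⟨?_, h1⟩
              by_contra h
              exact h2 ⟨hK.out hx hy h1, h⟩
          rw [this]
          exact isClosed_Icc.sdiff (hc C.2).2.isOpen_diff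
        refine IsCompact.nonempty_iInter_of_directed_nonempty_isCompact_isClosed _ ?_ ?_ ?_ hcl
        · intro C D
          rcases hchain.total C.2 D.2 with h | h
          · exact ⟨C, subset_rfl, Set.inter_subset_inter_left _ h⟩
          · exact ⟨D, Set.inter_subset_inter_left _ h, subset_rfl⟩
        · intro C
          obtain ⟨t, ht⟩ := (hc C.2).1
          obtain ⟨g, hg⟩ := hxy t ((hc C.2).2.subset ht)
          exact ⟨g • t, (hc C.2).2.smul_mem g t ht, hg⟩
        · exact fun C => isCompact_Icc.of_isClosed_subset (hcl C) Set.inter_subset_right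
      obtain ⟨t, ht⟩ := hne
      exact ⟨t, fun C hC => (Set.mem_iInter.mp ht ⟨C, hC⟩).1⟩
    · obtain ⟨C, hC⟩ := hcne
      exact (Set.sInter_subset_of_mem hC).trans (hc hC).2.subset
    · rw [Set.sInter_eq_iInter, Set.sdiff_iInter]
      exact isOpen_iUnion fun C => (hc C.2).2.isOpen_diff
    · exact fun g t ht C hC => (hc hC).2.smul_mem g t (ht C hC))
  exact ⟨C, hC.prop.2, hC.prop.1, fun D hDC hDne hD =>
    Set.Subset.antisymm hDC (hC.le_of_le ⟨hDne, hD⟩ hDC)⟩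

end fixedPoints

/-! ### Minimal sets of nilpotent groups -/

/-- An element that is central modulo the center, but not central, has such a commutator. -/
theorem exists_commutator_mem_center {Q : Type*} [Group Q] [Group.IsNilpotent Q]
    (h : ¬ ∀ a b : Q, a * b = b * a) :
    ∃ a b : Q, ⁅a, b⁆ ≠ 1 ∧ ⁅a, b⁆ ∈ Subgroup.center Q := by
  have hne : Subgroup.center Q ≠ ⊤ := fun htop => h fun a b =>
    (Subgroup.mem_center_iff.mp (htop ▸ Subgroup.mem_top b : b ∈ Subgroup.center Q) a)
  have : Nontrivial (Q ⧸ Subgroup.center Q) := QuotientGroup.nontrivial_iff.mpr hne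
  obtain ⟨⟨⟨a⟩, ha⟩, ha1⟩ := Subgroup.ne_bot_iff_exists_ne_one.mp
    (Group.IsNilpotent.center_ne_bot (Q ⧸ Subgroup.center Q))
  change (a : Q ⧸ Subgroup.center Q) ∈ _ at ha
  have ha2 : a ∉ Subgroup.center Q := fun h2 =>
    ha1 (Subtype.ext ((QuotientGroup.eq_one_iff a).mpr h2))
  rw [Subgroup.mem_center_iff] at ha2
  push Not at ha2
  obtain ⟨b, hb⟩ := ha2
  refine ⟨a, b, fun h1 => hb (commutatorElement_eq_one_iff_mul_comm.mp h1).symm, ?_⟩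
  rw [← QuotientGroup.eq_one_iff]
  exact commutatorElement_eq_one_iff_mul_comm.mpr (Subgroup.mem_center_iff.mp ha b).symm

section

variable {Γ : Type*} [Group Γ] [MulAction Γ ℝ]

theorem IsInvariantClosedIn.normal_fixingSubgroup {K C : Set ℝ}
    (hC : IsInvariantClosedIn Γ K C) : (fixingSubgroup Γ C).Normal := by
  refine ⟨fun m hm g => ?_⟩
  rw [mem_fixingSubgroup_iff] at hm ⊢
  intro y hy
  rw [mul_smul, mul_smul, hm _ (hC.smul_mem g⁻¹ y hy), smul_inv_smul]

variable [IsMonotoneAction Γ ℝ]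

/-- The fixed points in `C` of an element that is central as far as `C` is concerned form an
invariant set, closed in `K`, hence all of `C` if there are any. -/
theorem IsMinimalIn.fixed_of_fixed {K C : Set ℝ} (hKo : IsOpen K) (hC : IsMinimalIn Γ K C) {z : Γ}
    (hz : ∀ k : Γ, ∀ x ∈ C, z • k • x = k • z • x) {p : ℝ} (hp : p ∈ C) (hpz : z • p = p) :
    ∀ x ∈ C, z • x = x := by
  have h : {x ∈ C | z • x = x} = C := by
    refine hC.eq_of_subset _ (Set.sep_subset _ _) ⟨p, hp, hpz⟩
      ⟨(Set.sep_subset _ _).trans hC.subset, ?_, ?_⟩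
    · have : K \ {x ∈ C | z • x = x} = (K \ C) ∪ (K ∩ {x | z • x ≠ x}) := by
        ext x
        simp only [Set.mem_sdiff, Set.mem_union, Set.mem_inter_iff, Set.mem_ofPred_eq]
        tauto
      rw [this]
      exact hC.isOpen_diff.union (hKo.inter (isOpen_ne_fun (continuous_const_smul z) continuous_id))
    · rintro g x ⟨hx, hxz⟩
      refine ⟨hC.smul_mem g x hx, ?_⟩
      rw [hz g x hx, hxz]
  intro x hx
  rw [← h] at hx
  exact hx.2

theorem IsMinimalIn.lt_or_lt {K C : Set ℝ} (hKo : IsOpen K) (hC : IsMinimalIn Γ K C) {z : Γ}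
    (hz : ∀ k : Γ, ∀ x ∈ C, z • k • x = k • z • x) (hne : ∃ x ∈ C, z • x ≠ x) :
    (∀ x ∈ C, x < z • x) ∨ ∀ x ∈ C, z • x < x := by
  have hnofix : ∀ x ∈ C, z • x ≠ x := by
    intro x hx hxz
    obtain ⟨y, hy, hyz⟩ := hne
    exact hyz (hC.fixed_of_fixed hKo hz hx hxz y hy)
  by_cases hE : ∃ x ∈ C, x ≤ z • x
  · left
    obtain ⟨p, hp, hpz⟩ := hE
    have h : {x ∈ C | x ≤ z • x} = C := by
      refine hC.eq_of_subset _ (Set.sep_subset _ _) ⟨p, hp, hpz⟩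
        ⟨(Set.sep_subset _ _).trans hC.subset, ?_, ?_⟩
      · have : K \ {x ∈ C | x ≤ z • x} = (K \ C) ∪ (K ∩ {x | z • x < x}) := by
          ext x
          simp only [Set.mem_sdiff, Set.mem_union, Set.mem_inter_iff, Set.mem_ofPred_eq, not_and,
            not_le]
          tauto
        rw [this]
        exact hC.isOpen_diff.union
          (hKo.inter (isOpen_lt (continuous_const_smul z) continuous_id))
      · rintro g x ⟨hx, hxz⟩
        refine ⟨hC.smul_mem g x hx, ?_⟩
        rw [hz g x hx]
        exact IsMonotoneAction.smul_le_smul g hxz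
    intro x hx
    refine lt_of_le_of_ne ?_ (hnofix x hx).symm
    rw [← h] at hx
    exact hx.2
  · right
    push Not at hE
    exact hE

/-- If an orbit of `z` were bounded in `K`, its supremum would be fixed by `z`. -/
theorem IsInvariantClosedIn.exists_le_pow_smul {K C : Set ℝ} (hK : K.OrdConnected)
    (hC : IsInvariantClosedIn Γ K C) {z : Γ} (hpos : ∀ x ∈ C, x < z • x) {x y : ℝ} (hx : x ∈ C)
    (hy : y ∈ C) : ∃ n : ℕ, y ≤ z ^ n • x := by
  by_contra hcon
  push Not at hcon
  have hnat : ∀ n : ℕ, x ≤ z ^ n • x := by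
    intro n
    induction n with
    | zero => simp
    | succ n ih =>
      rw [pow_succ', mul_smul]
      exact ih.trans (hpos _ (hC.smul_mem _ _ hx)).le
  obtain ⟨p, hp, hpz⟩ := exists_fixed_of_forall_ge (Γ := Subgroup.zpowers z) hK (hC.subgroup _) hx
    (hC.subset hy) (by
      rintro ⟨_, k, rfl⟩
      change z ^ k • x ≤ y
      rcases Int.eq_nat_or_neg k with ⟨n, rfl | rfl⟩
      · rw [zpow_natCast]; exact (hcon n).le
      · rw [zpow_neg, zpow_natCast, inv_smul_le_iff_of_monotone]
        have hxy : x ≤ y := by simpa using (hcon 0).le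
        exact (hnat n).trans (IsMonotoneAction.smul_le_smul _ hxy))
  exact (hpos p hp).ne' (hpz ⟨z, Subgroup.mem_zpowers z⟩)

theorem IsMinimalIn.not_forall_lt_commutator {K C : Set ℝ} (hK : K.OrdConnected)
    (hC : IsMinimalIn Γ K C) (g h : Γ) (hz : ∀ k : Γ, ∀ x ∈ C, ⁅g, h⁆ • k • x = k • ⁅g, h⁆ • x) :
    ¬ ∀ x ∈ C, x < ⁅g, h⁆ • x := by
  intro hpos
  let S : SubMulAction Γ ℝ := ⟨C, fun g {x} hx => hC.smul_mem g x hx⟩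
  have : IsMonotoneAction Γ S := ⟨fun g _ _ hxy => IsMonotoneAction.smul_le_smul (X := ℝ) g hxy⟩
  obtain ⟨x, hx⟩ := hC.nonempty
  refine false_of_cofinal_central_commutator (X := S) g h ⁅g, h⁆
    (fun k y => Subtype.ext (hz k y y.2)) (fun y => ?_) (fun y => hpos y y.2) ⟨x, hx⟩ fun y =>
    hC.exists_le_pow_smul hK hpos hx y.2
  simp only [← mul_smul]
  congr 1
  simp [commutatorElement_def]

/-- A nilpotent group acts on a minimal set through an abelian quotient. Otherwise the quotient by
the kernel has a nontrivial central commutator; it moves all points of the minimal set in the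
same direction, and its orbits are cofinal. -/
theorem IsMinimalIn.smul_comm_of_isNilpotent [Group.IsNilpotent Γ] {K C : Set ℝ}
    (hK : K.OrdConnected) (hKo : IsOpen K) (hC : IsMinimalIn Γ K C) :
    ∀ g h : Γ, ∀ x ∈ C, g • h • x = h • g • x := by
  have hN := hC.normal_fixingSubgroup
  set N := fixingSubgroup Γ C
  have hcomm : ∀ (a b : Γ), ⁅a, b⁆ ∈ N → ∀ x ∈ C, a • b • x = b • a • x := by
    intro a b hab x hx
    have h1 := (mem_fixingSubgroup_iff _).mp hab _ (hC.smul_mem b _ (hC.smul_mem a x hx))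
    rw [← h1]
    simp only [← mul_smul]
    congr 1
    simp [commutatorElement_def]
  by_cases hab : ∀ a b : Γ ⧸ N, a * b = b * a
  · intro g h
    refine hcomm g h ?_
    rw [← QuotientGroup.eq_one_iff]
    exact commutatorElement_eq_one_iff_mul_comm.mpr (hab g h)
  exfalso
  have : Group.IsNilpotent (Γ ⧸ N) :=
    Group.nilpotent_of_surjective (QuotientGroup.mk' N) (QuotientGroup.mk'_surjective N)
  obtain ⟨⟨g⟩, ⟨h⟩, hne, hcen⟩ := exists_commutator_mem_center hab
  change ((⁅g, h⁆ : Γ) : Γ ⧸ N) ≠ 1 at hne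
  change ((⁅g, h⁆ : Γ) : Γ ⧸ N) ∈ _ at hcen
  have hz : ∀ k : Γ, ∀ x ∈ C, ⁅g, h⁆ • k • x = k • ⁅g, h⁆ • x := by
    intro k
    refine hcomm _ k ?_
    rw [← QuotientGroup.eq_one_iff]
    exact commutatorElement_eq_one_iff_mul_comm.mpr (Subgroup.mem_center_iff.mp hcen k).symm
  have hmove : ∃ x ∈ C, ⁅g, h⁆ • x ≠ x := by
    by_contra hcon
    push Not at hcon
    exact hne ((QuotientGroup.eq_one_iff _).mpr ((mem_fixingSubgroup_iff _).mpr hcon))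
  rcases hC.lt_or_lt hKo hz hmove with hpos | hneg
  · exact hC.not_forall_lt_commutator hK g h hz hpos
  · refine hC.not_forall_lt_commutator hK h g ?_ ?_
    · intro k x hx
      rw [← commutatorElement_inv g h, inv_smul_eq_iff, hz k _ (hC.smul_mem _ _ hx), smul_inv_smul]
    · intro x hx
      rw [← commutatorElement_inv g h, ← smul_lt_smul_iff_of_monotone ⁅g, h⁆, smul_inv_smul]
      exact hneg x hx

end

/-! ### Wandering sets and minimal blocks -/

section blocks

variable (Γ : Type*) {X : Type*} [Group Γ] [MulAction Γ X]

/-- Group elements that do not move `J` off itself fix every point of `J`. -/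
def IsWanderingSet (J : Set X) : Prop :=
  ∀ g : Γ, ∀ x ∈ J, g • x ∈ J → ∀ y ∈ J, g • y = y

/-- Every translate of `J` is equal to `J` or disjoint from it. As this is required of all group
elements, it is enough that those that do not move `J` off itself map it into itself. -/
def IsBlockSet (J : Set X) : Prop :=
  ∀ g : Γ, ∀ x ∈ J, g • x ∈ J → ∀ y ∈ J, g • y ∈ J

/-- A set whose translates are equal to it or disjoint from it, in which all orbits are dense and
on which its stabilizer acts as an abelian group. -/
structure IsMinimalBlock [TopologicalSpace X] (J : Set X) : Prop where
  block : IsBlockSet Γ J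
  dense : ∀ x ∈ J, J ⊆ closure (MulAction.orbit Γ x)
  smul_comm : ∀ g h : Γ, ∀ x ∈ J, g • x ∈ J → h • x ∈ J → g • h • x = h • g • x

variable {Γ}

theorem IsWanderingSet.block {J : Set X} (h : IsWanderingSet Γ J) : IsBlockSet Γ J :=
  fun g x hx hgx y hy => by rwa [h g x hx hgx y hy]

theorem IsBlockSet.smul_eq {J : Set X} (h : IsBlockSet Γ J) {g : Γ} {x : X} (hx : x ∈ J)
    (hgx : g • x ∈ J) : g • J = J := by
  refine Set.Subset.antisymm ?_ fun y hy => ?_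
  · rintro _ ⟨y, hy, rfl⟩
    exact h g x hx hgx y hy
  · rw [Set.mem_smul_set_iff_inv_smul_mem]
    exact h g⁻¹ _ hgx (by rwa [inv_smul_smul]) y hy

theorem IsWanderingSet.of_stabilizer {J K : Set X} (hK : IsBlockSet Γ K) (hJK : J ⊆ K)
    (hJ : IsWanderingSet (MulAction.stabilizer Γ K) J) : IsWanderingSet Γ J :=
  fun g x hx hgx => hJ ⟨g, hK.smul_eq (hJK hx) (hJK hgx)⟩ x hx hgx

theorem IsMinimalBlock.of_stabilizer [TopologicalSpace X] {J K : Set X} (hK : IsBlockSet Γ K)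
    (hJK : J ⊆ K) (hJ : IsMinimalBlock (MulAction.stabilizer Γ K) J) : IsMinimalBlock Γ J where
  block g x hx hgx := hJ.block ⟨g, hK.smul_eq (hJK hx) (hJK hgx)⟩ x hx hgx
  dense x hx := (hJ.dense x hx).trans (closure_mono (by rintro _ ⟨g, rfl⟩; exact ⟨g, rfl⟩))
  smul_comm g h x hx hgx hhx := hJ.smul_comm ⟨g, hK.smul_eq (hJK hx) (hJK hgx)⟩
    ⟨h, hK.smul_eq (hJK hx) (hJK hhx)⟩ x hx hgx hhx

theorem isBlockSet_connectedComponentIn [TopologicalSpace X] [ContinuousConstSMul Γ X] {S : Set X}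
    (hS : ∀ g : Γ, ∀ x ∈ S, g • x ∈ S) (x : X) : IsBlockSet Γ (connectedComponentIn S x) := by
  intro g y hy hgy w hw
  have h1 : (g • ·) '' connectedComponentIn S x ⊆ connectedComponentIn S (g • y) := by
    refine (isPreconnected_connectedComponentIn.image _
      (continuous_const_smul g).continuousOn).subset_connectedComponentIn ⟨y, hy, rfl⟩ ?_
    rintro _ ⟨t, ht, rfl⟩
    exact hS g t (connectedComponentIn_subset S x ht)
  rw [connectedComponentIn_eq hgy]
  exact h1 ⟨w, hw, rfl⟩

end blocks

/-- Every invariant open interval of a nilpotent group of finite Hirsch length contains an open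
interval that is wandering or a minimal block. The proof is by induction on the Hirsch length: a
minimal set either is an interval, on which the action is minimal and abelian, or has a
complementary interval, whose stabilizer has smaller Hirsch length because it fixes the minimal
set pointwise. -/
theorem exists_wandering_or_minimalBlock_of_isNilpotent (n : ℕ) :
    ∀ (Γ : Type u) [Group Γ] [Group.IsNilpotent Γ] [MulAction Γ ℝ] [IsMonotoneAction Γ ℝ],
    HirschLengthLE n Γ → ∀ K : Set ℝ, K.OrdConnected → IsOpen K → K.Nonempty →
    (∀ g : Γ, ∀ x ∈ K, g • x ∈ K) → ∃ J ⊆ K, IsOpen J ∧ J.Nonempty ∧ J.OrdConnected ∧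
      (IsWanderingSet Γ J ∨ IsMinimalBlock Γ J) := by
  induction n using Nat.strong_induction_on with
  | h n ih =>
  intro Γ _ _ _ _ hΓ K hK hKo hKne hinv
  have := hΓ.fg
  by_cases htriv : ∀ x ∈ K, ∀ g : Γ, g • x = x
  · exact ⟨K, subset_rfl, hKo, hKne, hK, .inl fun g _ _ _ y hy => htriv y hy g⟩
  push Not at htriv
  obtain ⟨x₀, hx₀, g₀, hg₀⟩ := htriv
  -- the component `K₁` of `x₀` in the set of points without global fixed points
  set S : Set ℝ := K ∩ ⋃ g : Γ, {x | g • x ≠ x} with hS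
  have hSo : IsOpen S := hKo.inter (isOpen_iUnion fun g =>
    isOpen_ne_fun (continuous_const_smul g) continuous_id)
  have hSinv : ∀ g : Γ, ∀ x ∈ S, g • x ∈ S := by
    rintro g x ⟨hx, hx'⟩
    obtain ⟨k, hk⟩ := Set.mem_iUnion.mp hx'
    refine ⟨hinv g x hx, Set.mem_iUnion.mpr ⟨g * k * g⁻¹, fun h => hk ?_⟩⟩
    rw [mul_smul, inv_smul_smul, mul_smul] at h
    exact MulAction.injective g h
  have hx₀S : x₀ ∈ S := ⟨hx₀, Set.mem_iUnion.mpr ⟨g₀, hg₀⟩⟩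
  set K₁ := connectedComponentIn S x₀ with hK₁
  have hK₁S : K₁ ⊆ S := connectedComponentIn_subset S x₀
  have hx₀K₁ : x₀ ∈ K₁ := mem_connectedComponentIn hx₀S
  have hK₁oc : K₁.OrdConnected := isPreconnected_connectedComponentIn.ordConnected
  have hK₁o : IsOpen K₁ := hSo.connectedComponentIn
  have hK₁inv : ∀ g : Γ, ∀ x ∈ K₁, g • x ∈ K₁ := by
    intro g
    refine isBlockSet_connectedComponentIn hSinv x₀ g x₀ hx₀K₁ ?_
    have h1 : Set.uIcc x₀ (g • x₀) ⊆ S := by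
      intro t ht
      refine ⟨hK.uIcc_subset hx₀ (hinv g x₀ hx₀) ht, ?_⟩
      by_contra hfix
      simp only [Set.mem_iUnion, Set.mem_ofPred_eq, not_exists, not_not] at hfix
      have h2 : t = x₀ := by
        rcases Set.mem_uIcc.mp ht with ⟨h3, h4⟩ | ⟨h3, h4⟩
        · refine le_antisymm ?_ h3
          rw [← hfix g] at h4
          exact (smul_le_smul_iff_of_monotone g).mp h4
        · refine le_antisymm h4 ?_
          rw [← hfix g] at h3
          exact (smul_le_smul_iff_of_monotone g).mp h3
      exact hg₀ (h2 ▸ hfix g₀)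
    exact isPreconnected_uIcc.subset_connectedComponentIn Set.left_mem_uIcc h1
      Set.right_mem_uIcc
  have hK₁K : K₁ ⊆ K := fun x hx => (hK₁S hx).1
  obtain ⟨C, hC⟩ := exists_isMinimalIn hK₁oc ⟨x₀, hx₀K₁⟩ hK₁inv fun x hx =>
    Set.mem_iUnion.mp (hK₁S hx).2
  have hcomm := hC.smul_comm_of_isNilpotent hK₁oc hK₁o
  by_cases hCK : C = K₁
  · subst hCK
    refine ⟨K₁, hK₁K, hK₁o, ⟨x₀, hx₀K₁⟩, hK₁oc, .inr
      ⟨fun g _ _ _ => hK₁inv g, fun x hx => ?_, fun g h x hx _ _ => hcomm g h x hx⟩⟩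
    have h1 : K₁ ∩ closure (MulAction.orbit Γ x) = K₁ := by
      refine hC.eq_of_subset _ Set.inter_subset_left
        ⟨x, hx, subset_closure (MulAction.mem_orbit_self x)⟩ ⟨Set.inter_subset_left, ?_, ?_⟩
      · rw [Set.sdiff_self_inter]
        exact hK₁o.sdiff isClosed_closure
      · rintro g y ⟨hy, hy'⟩
        refine ⟨hK₁inv g y hy, ?_⟩
        refine map_mem_closure (continuous_const_smul g) hy' ?_
        exact fun a ha => MulAction.mem_orbit_of_mem_orbit g ha
    rw [← h1]
    exact Set.inter_subset_right
  -- a complementary interval `L` of the minimal set, and its stabilizer `H`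
  obtain ⟨x₁, hx₁, hx₁C⟩ : ∃ x ∈ K₁, x ∉ C := by
    by_contra hcon
    push Not at hcon
    exact hCK (hC.subset.antisymm hcon)
  have hdinv : ∀ g : Γ, ∀ x ∈ K₁ \ C, g • x ∈ K₁ \ C := fun g x hx =>
    ⟨hK₁inv g x hx.1, fun h => hx.2 (hC.smul_mem_iff g |>.mp h)⟩
  set L := connectedComponentIn (K₁ \ C) x₁ with hL
  have hLo : IsOpen L := hC.isOpen_diff.connectedComponentIn
  have hLoc : L.OrdConnected := isPreconnected_connectedComponentIn.ordConnected
  have hLsub : L ⊆ K₁ \ C := connectedComponentIn_subset _ _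
  have hx₁L : x₁ ∈ L := mem_connectedComponentIn ⟨hx₁, hx₁C⟩
  have hLblock : IsBlockSet Γ L := isBlockSet_connectedComponentIn hdinv x₁
  set H := MulAction.stabilizer Γ L with hH
  have hHinv : ∀ g : H, ∀ x ∈ L, g • x ∈ L := by
    intro g x hx
    have h1 : (g : Γ) • L = L := g.2
    have h2 : (g : Γ) • x ∈ (g : Γ) • L := Set.smul_mem_smul_set hx
    rwa [h1] at h2
  have hHN : H ≤ fixingSubgroup Γ C := by
    obtain ⟨l, hl⟩ := hC.nonempty
    have hlL : l ∉ L := fun h => (hLsub h).2 hl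
    -- an orbit of `H` in `C` stays on one side of `L`, so that `H` has a fixed point in `C`
    have hp : ∃ p ∈ C, ∀ g : H, g • p = p := by
      rcases lt_or_ge x₁ l with hlt | hge
      · refine exists_fixed_of_forall_le hK₁oc (hC.subgroup H) hl hx₁ fun g => ?_
        rw [← inv_smul_le_iff_of_monotone]
        by_contra hcon
        exact hlL (hLoc.out hx₁L (hHinv g⁻¹ x₁ hx₁L) ⟨hlt.le, (not_le.mp hcon).le⟩)
      · refine exists_fixed_of_forall_ge hK₁oc (hC.subgroup H) hl hx₁ fun g => ?_
        rw [← le_inv_smul_iff_of_monotone]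
        by_contra hcon
        exact hlL (hLoc.out (hHinv g⁻¹ x₁ hx₁L) hx₁L ⟨(not_le.mp hcon).le, hge⟩)
    obtain ⟨p, hp, hpf⟩ := hp
    intro g hg
    rw [mem_fixingSubgroup_iff]
    exact hC.fixed_of_fixed hK₁o (fun k x hx => hcomm g k x hx) hp (hpf ⟨g, hg⟩)
  obtain ⟨l, hl⟩ := hC.nonempty
  obtain ⟨g₁, hg₁⟩ := Set.mem_iUnion.mp (hK₁S (hC.subset hl)).2
  obtain ⟨m, hmn, hm⟩ := hΓ.exists_lt_of_normal _ hC.normal_fixingSubgroup g₁ fun k hk hk' =>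
    hg₁ (pow_smul_eq_self_imp hk ((mem_fixingSubgroup_iff _).mp hk' l hl))
  obtain ⟨J, hJL, hJo, hJne, hJoc, hJ⟩ := ih m hmn H (hm.of_le hHN) L hLoc hLo ⟨x₁, hx₁L⟩ hHinv
  refine ⟨J, hJL.trans ((hLsub.trans Set.sdiff_subset).trans hK₁K), hJo, hJne, hJoc, ?_⟩
  exact hJ.imp (.of_stabilizer hLblock hJL) (.of_stabilizer hLblock hJL)

/-! ### Translation coordinates for minimal abelian actions -/

section translation

variable {Γ : Type*} [Group Γ] [MulAction Γ ℝ]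

theorem isMinimalIn_univ (hdense : ∀ x : ℝ, Dense (MulAction.orbit Γ x)) :
    IsMinimalIn Γ Set.univ Set.univ := by
  refine ⟨⟨subset_rfl, by simp, fun _ _ _ => trivial⟩, Set.univ_nonempty, ?_⟩
  rintro D - ⟨x, hx⟩ hD
  have h1 : IsClosed D := ⟨by rw [Set.compl_eq_univ_sdiff]; exact hD.isOpen_diff⟩
  refine Set.eq_univ_of_univ_subset ?_
  rw [← (hdense x).closure_eq]
  refine closure_minimal ?_ h1
  rintro _ ⟨g, rfl⟩
  exact hD.smul_mem g x hx

/-- A commutative group of homeomorphisms of the line with dense orbits preserves the orientation: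
an orientation-reversing element would have a fixed point, hence fix a dense orbit. -/
theorem isMonotoneAction_of_smul_comm [ContinuousConstSMul Γ ℝ]
    (hcomm : ∀ (g h : Γ) (x : ℝ), g • h • x = h • g • x)
    (hdense : ∀ x : ℝ, Dense (MulAction.orbit Γ x)) : IsMonotoneAction Γ ℝ := by
  refine ⟨fun g x y hxy => ?_⟩
  have hc : Continuous fun x : ℝ => g • x := continuous_const_smul g
  rcases hc.strictMono_of_inj (MulAction.injective g) with h | h
  · exact h.monotone hxy
  exfalso
  obtain ⟨p, hp⟩ : ∃ p : ℝ, g • p - p = 0 := by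
    have hc' : Continuous fun x : ℝ => g • x - x := hc.sub continuous_id
    rcases le_or_gt 0 (g • (0 : ℝ)) with h0 | h0
    · exact mem_range_of_exists_le_of_exists_ge hc' ⟨g • 0, sub_nonpos.mpr (h.antitone h0)⟩
        ⟨0, by simpa using h0⟩
    · exact mem_range_of_exists_le_of_exists_ge hc' ⟨0, by simpa using h0.le⟩
        ⟨g • 0, sub_nonneg.mpr (h.antitone h0.le)⟩
  have h1 : (fun x : ℝ => g • x) = id := by
    refine Continuous.ext_on (hdense p) hc continuous_id ?_
    rintro _ ⟨k, rfl⟩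
    change g • k • p = k • p
    rw [hcomm, sub_eq_zero.mp hp]
  have h2 := h (zero_lt_one (α := ℝ))
  rw [h1] at h2
  exact absurd h2 (by norm_num)

variable [IsMonotoneAction Γ ℝ]

/-- Hölder's theorem on archimedean ordered groups, applied to a commutative group acting on the
line with dense orbits, which is ordered by its action on the point `0`. -/
theorem exists_translation_number (hcomm : ∀ (g h : Γ) (x : ℝ), g • h • x = h • g • x)
    (hdense : ∀ x : ℝ, Dense (MulAction.orbit Γ x)) :
    ∃ τ : Γ → ℝ, (∀ g h, τ (g * h) = τ g + τ h) ∧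
      ∀ g h, τ g < τ h ↔ g • (0 : ℝ) < h • (0 : ℝ) := by
  have hmin := isMinimalIn_univ hdense
  let ev : (MulAction.toPermHom Γ ℝ).range → ℝ := fun σ => (σ : Equiv.Perm ℝ) 0
  have hev : Function.Injective ev := by
    rintro ⟨_, g, rfl⟩ ⟨_, h, rfl⟩ hgh
    have hgh' : g • (0 : ℝ) = h • (0 : ℝ) := hgh
    have h1 : ∀ x ∈ (Set.univ : Set ℝ), (h⁻¹ * g) • x = x := by
      refine hmin.fixed_of_fixed isOpen_univ (fun k x _ => hcomm _ k x) (Set.mem_univ (0 : ℝ)) ?_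
      rw [mul_smul, hgh', inv_smul_smul]
    refine Subtype.ext (Equiv.ext fun x => ?_)
    have h2 := h1 x trivial
    rw [mul_smul, inv_smul_eq_iff] at h2
    exact h2
  let _ : CommGroup (MulAction.toPermHom Γ ℝ).range :=
    { (inferInstance : Group (MulAction.toPermHom Γ ℝ).range) with
      mul_comm := by
        rintro ⟨_, g, rfl⟩ ⟨_, h, rfl⟩
        exact Subtype.ext (Equiv.ext fun x => hcomm g h x) }
  let _ : LinearOrder (MulAction.toPermHom Γ ℝ).range := LinearOrder.lift' ev hev
  have hord : IsOrderedMonoid (MulAction.toPermHom Γ ℝ).range := by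
    have h1 : ∀ a b : (MulAction.toPermHom Γ ℝ).range, a ≤ b → ∀ c, c * a ≤ c * b := by
      rintro a b hab ⟨_, k, rfl⟩
      exact IsMonotoneAction.smul_le_smul k (show ev a ≤ ev b from hab)
    exact { mul_le_mul_left := fun a b hab c => by
              rw [mul_comm a, mul_comm b]; exact h1 a b hab c }
  have harch : MulArchimedean (MulAction.toPermHom Γ ℝ).range := by
    refine ⟨?_⟩
    rintro ⟨_, g, rfl⟩ ⟨_, h, rfl⟩ hpos
    have h0 : (0 : ℝ) < h • (0 : ℝ) := hpos
    have h1 : ∀ x ∈ (Set.univ : Set ℝ), x < h • x := by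
      refine (hmin.lt_or_lt isOpen_univ (fun k x _ => hcomm h k x)
        ⟨0, trivial, h0.ne'⟩).resolve_right fun h2 => absurd (h2 0 trivial) h0.not_gt
    obtain ⟨n, hn⟩ := hmin.exists_le_pow_smul Set.ordConnected_univ h1 (x := 0) (y := g • 0)
      trivial trivial
    refine ⟨n, ?_⟩
    change ev _ ≤ ev _
    have h3 : ev ((⟨MulAction.toPermHom Γ ℝ h, h, rfl⟩ : (MulAction.toPermHom Γ ℝ).range) ^ n) =
        h ^ n • (0 : ℝ) := by
      have : ((⟨MulAction.toPermHom Γ ℝ h, h, rfl⟩ : (MulAction.toPermHom Γ ℝ).range) ^ n) =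
          ⟨MulAction.toPermHom Γ ℝ (h ^ n), h ^ n, rfl⟩ :=
        Subtype.ext (map_pow (MulAction.toPermHom Γ ℝ) h n).symm
      rw [this]
      rfl
    rw [h3]
    exact hn
  obtain ⟨f, hf⟩ := Archimedean.exists_orderAddMonoidHom_real_injective
    (Additive (MulAction.toPermHom Γ ℝ).range)
  have hfs : StrictMono f := (OrderHomClass.mono f).strictMono_of_injective hf
  refine ⟨fun g => f (Additive.ofMul ⟨MulAction.toPermHom Γ ℝ g, g, rfl⟩), fun g h => ?_,
    fun g h => hfs.lt_iff_lt⟩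
  have h1 : (⟨MulAction.toPermHom Γ ℝ (g * h), g * h, rfl⟩ : (MulAction.toPermHom Γ ℝ).range) =
      ⟨MulAction.toPermHom Γ ℝ g, g, rfl⟩ * ⟨MulAction.toPermHom Γ ℝ h, h, rfl⟩ :=
    Subtype.ext (map_mul (MulAction.toPermHom Γ ℝ) g h)
  exact (congrArg (fun q => f (Additive.ofMul q)) h1).trans (map_add f _ _)

/-- The coordinate of a point `t` is the supremum of the translation numbers of the elements that
move `0` to a point not above `t`. It is a homeomorphism since the translation numbers are dense. -/
theorem exists_translation_coordinate (hcomm : ∀ (g h : Γ) (x : ℝ), g • h • x = h • g • x)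
    (hdense : ∀ x : ℝ, Dense (MulAction.orbit Γ x)) :
    ∃ (p : ℝ ≃o ℝ) (τ : Γ → ℝ), ∀ (g : Γ) (x : ℝ), p (g • x) = p x + τ g := by
  obtain ⟨τ, hmul, hlt⟩ := exists_translation_number hcomm hdense
  have hle : ∀ g h, τ g ≤ τ h ↔ g • (0 : ℝ) ≤ h • (0 : ℝ) := fun g h => by
    rw [← not_lt, hlt, not_lt]
  have hbetween : ∀ s t : ℝ, s < t → ∃ g : Γ, s < g • (0 : ℝ) ∧ g • (0 : ℝ) < t := by
    intro s t hst
    obtain ⟨_, ⟨g, rfl⟩, hg⟩ := (hdense 0).exists_between hst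
    exact ⟨g, hg⟩
  let A : ℝ → Set ℝ := fun t => {r | ∃ g : Γ, g • (0 : ℝ) ≤ t ∧ τ g = r}
  have hAub : ∀ t (h : Γ), t ≤ h • (0 : ℝ) → τ h ∈ upperBounds (A t) := by
    rintro t h hth _ ⟨g, hg, rfl⟩
    exact (hle g h).mpr (hg.trans hth)
  have hAbdd : ∀ t, BddAbove (A t) := fun t => by
    obtain ⟨h, hh, -⟩ := hbetween t (t + 1) (by linarith)
    exact ⟨τ h, hAub t h hh.le⟩
  have hAne : ∀ t, (A t).Nonempty := fun t => by
    obtain ⟨h, -, hh⟩ := hbetween (t - 1) t (by linarith)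
    exact ⟨τ h, h, hh.le, rfl⟩
  let p : ℝ → ℝ := fun t => sSup (A t)
  have hpg : ∀ g : Γ, p (g • (0 : ℝ)) = τ g := fun g =>
    le_antisymm (csSup_le (hAne _) (hAub _ g le_rfl)) (le_csSup (hAbdd _) ⟨g, le_rfl, rfl⟩)
  have hpmono : Monotone p := fun s t hst =>
    csSup_le_csSup (hAbdd t) (hAne s) fun r ⟨g, hg, hr⟩ => ⟨g, hg.trans hst, hr⟩
  have hpstrict : StrictMono p := by
    intro s t hst
    obtain ⟨g, hg1, hg2⟩ := hbetween s t hst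
    obtain ⟨h, hh1, hh2⟩ := hbetween _ t hg2
    have h1 := hpmono hg1.le
    have h2 := hpmono hh2.le
    rw [hpg] at h1 h2
    exact (h1.trans_lt ((hlt g h).mpr hh1)).trans_le h2
  have hone : τ 1 = 0 := by
    have h := hmul 1 1
    rw [one_mul] at h
    linarith
  have hinv : ∀ g, τ g⁻¹ = -τ g := fun g => by
    have h := hmul g⁻¹ g
    rw [inv_mul_cancel, hone] at h
    linarith
  let S : AddSubgroup ℝ :=
    { carrier := Set.range τ
      add_mem' := by
        rintro _ _ ⟨g, rfl⟩ ⟨h, rfl⟩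
        exact ⟨g * h, hmul g h⟩
      zero_mem' := ⟨1, hone⟩
      neg_mem' := by
        rintro _ ⟨g, rfl⟩
        exact ⟨g⁻¹, hinv g⟩ }
  have hpos : ∀ g : Γ, 0 < τ g ↔ 0 < g • (0 : ℝ) := fun g => by
    have h := hlt 1 g
    rwa [hone, one_smul] at h
  have hSdense : Dense (S : Set ℝ) := by
    refine S.dense_of_no_min ?_ ?_
    · obtain ⟨g, hg, -⟩ := hbetween 0 1 one_pos
      intro hbot
      have h1 : τ g ∈ S := ⟨g, rfl⟩
      rw [hbot, AddSubgroup.mem_bot] at h1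
      exact ((hpos g).mpr hg).ne' h1
    · rintro ⟨_, ⟨⟨g, rfl⟩, hg⟩, hmin⟩
      obtain ⟨h, hh1, hh2⟩ := hbetween 0 _ ((hpos g).mp hg)
      exact absurd ((hlt h g).mpr hh2) (not_lt.mpr (hmin ⟨⟨h, rfl⟩, (hpos h).mpr hh1⟩))
  have hprange : Dense (Set.range p) := hSdense.mono (by
    rintro _ ⟨g, rfl⟩
    exact ⟨_, hpg g⟩)
  have hpc : Continuous p := hpmono.continuous_of_denseRange hprange
  have hpsurj : Function.Surjective p := by
    intro y
    obtain ⟨_, ⟨a, rfl⟩, -, ha⟩ := hprange.exists_between (sub_one_lt y)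
    obtain ⟨_, ⟨b, rfl⟩, hb, -⟩ := hprange.exists_between (lt_add_one y)
    exact mem_range_of_exists_le_of_exists_ge hpc ⟨a, ha.le⟩ ⟨b, hb.le⟩
  refine ⟨hpstrict.orderIsoOfSurjective p hpsurj, τ, fun g x => ?_⟩
  change p (g • x) = p x + τ g
  have h1 : (fun x => p (g • x)) = fun x => p x + τ g := by
    refine Continuous.ext_on (hdense 0) (hpc.comp (continuous_const_smul g))
      (hpc.add continuous_const) ?_
    rintro _ ⟨h, rfl⟩
    change p (g • h • (0 : ℝ)) = p (h • (0 : ℝ)) + τ g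
    rw [← mul_smul, hpg, hpg, hmul, add_comm]
  exact congrFun h1 x

end translation

/-- A commutative group of homeomorphisms of an open interval with dense orbits acts by
translations in a suitable coordinate. -/
theorem exists_homeomorph_translation {H Y : Type*} [Group H] [TopologicalSpace Y] [MulAction H Y]
    [ContinuousConstSMul H Y] (e : Y ≃ₜ ℝ)
    (hcomm : ∀ (g h : H) (y : Y), g • h • y = h • g • y)
    (hdense : ∀ y : Y, Dense (MulAction.orbit H y)) :
    ∃ (p : Y ≃ₜ ℝ) (τ : H → ℝ), ∀ (g : H) (y : Y), p (g • y) = p y + τ g := by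
  let _ : MulAction H ℝ := e.symm.toEquiv.mulAction H
  have hsmul : ∀ (g : H) (x : ℝ), g • x = e (g • e.symm x) := fun _ _ => rfl
  have hcomm' : ∀ (g h : H) (x : ℝ), g • h • x = h • g • x := fun g h x => by
    simp only [hsmul, Homeomorph.symm_apply_apply]
    rw [hcomm]
  have hdense' : ∀ x : ℝ, Dense (MulAction.orbit H x) := fun x => by
    have h1 : MulAction.orbit H x = e '' MulAction.orbit H (e.symm x) := by
      ext t
      simp [MulAction.mem_orbit_iff, hsmul]
    rw [h1]
    exact e.surjective.denseRange.dense_image e.continuous (hdense _)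
  have : ContinuousConstSMul H ℝ :=
    ⟨fun g => e.continuous.comp ((continuous_const_smul g).comp e.symm.continuous)⟩
  have := isMonotoneAction_of_smul_comm hcomm' hdense'
  obtain ⟨p, τ, hp⟩ := exists_translation_coordinate hcomm' hdense'
  refine ⟨e.trans p.toHomeomorph, τ, fun g y => ?_⟩
  have h1 := hp g (e y)
  rw [hsmul, e.symm_apply_apply] at h1
  exact h1

/-- A continuous map of the line that conjugates a dense set of translations to translations is
affine. -/
theorem eq_affine_of_dense_translations {k : ℝ → ℝ} (hk : Continuous k) {D : Set ℝ} (hD : Dense D)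
    (h : ∀ d ∈ D, ∃ s : ℝ, ∀ t, k (t + d) = k t + s) (t : ℝ) :
    k t = k 0 + (k 1 - k 0) * t := by
  have h1 : ∀ s t : ℝ, k (t + s) = k t + (k s - k 0) := by
    intro s t
    have h2 : (fun s => k (t + s)) = fun s => k t + (k s - k 0) := by
      refine Continuous.ext_on hD (by fun_prop) (by fun_prop) fun d hd => ?_
      obtain ⟨s, hs⟩ := h d hd
      have h3 := hs 0
      rw [zero_add] at h3
      change k (t + d) = k t + (k d - k 0)
      rw [hs, h3]
      ring
    exact congrFun h2 s
  let f : ℝ →+ ℝ :=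
    { toFun := fun s => k s - k 0
      map_zero' := sub_self _
      map_add' := fun s t => by
        rw [h1]
        ring }
  have h2 := map_real_smul f (by change Continuous fun s => k s - k 0; fun_prop) t 1
  change k (t • 1) - k 0 = t • (k 1 - k 0) at h2
  rw [smul_eq_mul, smul_eq_mul, mul_one] at h2
  linarith

/-- A nonempty open order-connected subset of the line is homeomorphic to the line. -/
theorem nonempty_homeomorph_real {J : Set ℝ} (hJo : IsOpen J) (hJne : J.Nonempty)
    (hJ : J.OrdConnected) : Nonempty (J ≃ₜ ℝ) := by
  -- the line is homeomorphic to the unit ball, so `J` may be assumed to be bounded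
  let b : ℝ ≃ₜ Metric.ball (0 : ℝ) 1 := Homeomorph.unitBall
  set J' : Set ℝ := Subtype.val '' (b '' J) with hJ'
  have hJ'o : IsOpen J' := Metric.isOpen_ball.isOpenMap_subtype_val _ (b.isOpenMap _ hJo)
  have hpre : IsPreconnected J' :=
    (hJ.isPreconnected.image b b.continuous.continuousOn).image _
      continuous_subtype_val.continuousOn
  have hJ'ne : J'.Nonempty := (hJne.image b).image _
  have hsub : J' ⊆ Metric.ball 0 1 := by
    rintro _ ⟨x, -, rfl⟩
    exact x.2
  have hbdd := Metric.isBounded_ball.subset hsub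
  have hIoo : J' = Set.Ioo (sInf J') (sSup J') := by
    refine Set.Subset.antisymm (fun x hx => ?_)
      ((show IsConnected J' from ⟨hJ'ne, hpre⟩).Ioo_csInf_csSup_subset hbdd.bddBelow hbdd.bddAbove)
    obtain ⟨ε, hε, hball⟩ := Metric.isOpen_iff.mp hJ'o x hx
    have h1 : x - ε / 2 ∈ J' := hball (by simp [abs_of_pos hε]; linarith)
    have h2 : x + ε / 2 ∈ J' := hball (by simp [abs_of_pos hε]; linarith)
    exact ⟨by linarith [csInf_le hbdd.bddBelow h1], by linarith [le_csSup hbdd.bddAbove h2]⟩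
  have hlt : sInf J' < sSup J' := by
    obtain ⟨x, hx⟩ := hJ'ne
    rw [hIoo] at hx
    exact hx.1.trans hx.2
  have e₁ : J ≃ₜ J' :=
    (b.image J).trans (Topology.IsEmbedding.subtypeVal.homeomorphImage (b '' J))
  let c := OpenPartialHomeomorph.univBall ((sInf J' + sSup J') / 2) ((sSup J' - sInf J') / 2)
  have hsrc : c.source = Set.univ := OpenPartialHomeomorph.univBall_source _ _
  have htgt : c.target = J' := by
    rw [hIoo, Real.Ioo_eq_ball]
    exact OpenPartialHomeomorph.univBall_target _ (by linarith)
  have e₂ : ℝ ≃ₜ J' := (Homeomorph.Set.univ ℝ).symm.trans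
    ((Homeomorph.setCongr hsrc.symm).trans
      (c.toHomeomorphSourceTarget.trans (Homeomorph.setCongr htgt)))
  exact ⟨e₁.trans e₂.symm⟩

/-! ### From nilpotent to virtually nilpotent groups -/

theorem dense_range_of_translation {H Y : Type*} [Group H] [TopologicalSpace Y] [MulAction H Y]
    (p : Y ≃ₜ ℝ) {τ : H → ℝ} (hdense : ∀ y : Y, Dense (MulAction.orbit H y)) (y : Y)
    (hp : ∀ (g : H) (y : Y), p (g • y) = p y + τ g) : Dense (Set.range τ) := by
  have h1 := (p.trans (Homeomorph.subRight (p y))).surjective.denseRange.dense_image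
    (p.trans (Homeomorph.subRight (p y))).continuous (hdense y)
  refine h1.mono ?_
  rintro _ ⟨_, ⟨g, rfl⟩, rfl⟩
  refine ⟨g, ?_⟩
  simp [hp]

section finiteIndex

variable {Γ : Type*} [Group Γ] [MulAction Γ ℝ] [IsMonotoneAction Γ ℝ] (N : Subgroup Γ) [N.Normal]

/-- If a translate `g • J` meets `J`, then `J` is covered by the translates of `g • J` under the normal
subgroup, because its orbits are dense in `J`. These are open and disjoint, and `J` is connected, so
that `J` is contained in `g • J`. -/
theorem IsMinimalBlock.isBlockSet_of_normal {J : Set ℝ} (hJo : IsOpen J) (hJoc : J.OrdConnected)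
    (hJ : IsMinimalBlock N J) : IsBlockSet Γ J := by
  have key : ∀ g : Γ, ∀ x ∈ J, g • x ∈ J → J ⊆ g • J := by
    intro g x hx hgx
    have hgJ : IsBlockSet N (g • J) := by
      intro n y hy hny z hz
      rw [Set.mem_smul_set_iff_inv_smul_mem] at hy hny hz ⊢
      have hm := ‹N.Normal›.conj_mem _ n.2 g⁻¹
      rw [inv_inv] at hm
      have h1 : ∀ w : ℝ, (⟨_, hm⟩ : N) • g⁻¹ • w = g⁻¹ • n • w := by
        intro w
        change (g⁻¹ * (n : Γ) * g) • g⁻¹ • w = g⁻¹ • (n : Γ) • w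
        simp only [mul_smul, smul_inv_smul]
      rw [← h1] at hny ⊢
      exact hJ.block _ _ hy hny _ hz
    have ho : IsOpen (g • J) := hJo.smul g
    have ho' : IsOpen (⋃ (n : N) (_ : n • g • J ≠ g • J), n • g • J) :=
      isOpen_iUnion fun n => isOpen_iUnion fun _ => ho.smul n
    refine IsPreconnected.subset_left_of_subset_union ho ho' ?_ ?_
      ⟨g • x, hgx, Set.smul_mem_smul_set hx⟩ hJoc.isPreconnected
    · rw [Set.disjoint_left]
      intro y hy hy'
      obtain ⟨n, hn, hyn⟩ := Set.mem_iUnion₂.mp hy'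
      rw [Set.mem_smul_set_iff_inv_smul_mem] at hyn
      exact hn (hgJ.smul_eq hyn (by rwa [smul_inv_smul]))
    · intro e he
      obtain ⟨_, h1, n, rfl⟩ := mem_closure_iff.mp (hJ.dense e he hgx) _ ho
        (Set.smul_mem_smul_set hx)
      by_cases hn : n⁻¹ • g • J = g • J
      · left
        rw [← hn, Set.mem_smul_set_iff_inv_smul_mem, inv_inv]
        exact h1
      · right
        refine Set.mem_iUnion₂.mpr ⟨n⁻¹, hn, ?_⟩
        rw [Set.mem_smul_set_iff_inv_smul_mem, inv_inv]
        exact h1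
  intro g x hx hgx y hy
  have h1 := key g⁻¹ (g • x) hgx (by rwa [inv_smul_smul]) hy
  rwa [Set.mem_smul_set_iff_inv_smul_mem, inv_inv] at h1

variable [N.FiniteIndex]

/-- If `J` is wandering for a normal subgroup of finite index, then orbits of the whole group meet
`J` in boundedly many points. Near a point for which their number is maximal, these points vary
continuously and without further ones showing up, so that a small neighbourhood is wandering. -/
theorem IsWanderingSet.exists_of_finiteIndex {J : Set ℝ} (hJo : IsOpen J) (hJne : J.Nonempty)
    (hJ : IsWanderingSet N J) :
    ∃ J' ⊆ J, IsOpen J' ∧ J'.Nonempty ∧ J'.OrdConnected ∧ IsWanderingSet Γ J' := by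
  classical
  have hfix : ∀ g : Γ, ∀ x ∈ J, g • x = x → ∀ y ∈ J, g • y = y := by
    intro g x hx hgx y hy
    obtain ⟨m, hm0, -, hm⟩ := Subgroup.exists_pow_mem_of_index_ne_zero
      (H := N) Subgroup.FiniteIndex.index_ne_zero g
    have h1 : g ^ m • x = x := by
      clear hm hm0
      induction m with
      | zero => simp
      | succ m ih => rw [pow_succ, mul_smul, hgx, ih]
    exact pow_smul_eq_self_imp hm0 (hJ ⟨g ^ m, hm⟩ x hx
      (by change g ^ m • x ∈ J; rwa [h1]) y hy)
  let O : ℝ → Set ℝ := fun x => MulAction.orbit Γ x ∩ J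
  have hOinj : ∀ x, ∃ f : O x → Γ ⧸ N, Function.Injective f := by
    intro x
    choose γ hγ using fun y : O x => y.2.1
    refine ⟨fun y => (γ y : Γ ⧸ N), fun y z hyz => ?_⟩
    have h1 : γ z * (γ y)⁻¹ ∈ N := by
      have h2 := ‹N.Normal›.conj_mem _ (QuotientGroup.eq.mp hyz) (γ y)
      rwa [mul_inv_cancel_left] at h2
    have h3 : (γ z * (γ y)⁻¹) • (y : ℝ) = z := by
      have h4 : γ y • x = y := hγ y
      have h5 : γ z • x = z := hγ z
      rw [mul_smul, ← h4, inv_smul_smul, h5]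
    have h6 := hJ ⟨_, h1⟩ y y.2.2 (by change (γ z * (γ y)⁻¹) • (y : ℝ) ∈ J; rw [h3]; exact z.2.2)
      y y.2.2
    exact Subtype.ext (h6.symm.trans h3)
  have hOfin : ∀ x, Finite (O x) := fun x => by
    obtain ⟨f, hf⟩ := hOinj x
    exact Finite.of_injective f hf
  obtain ⟨x, hx, hmax⟩ : ∃ x ∈ J, ∀ y ∈ J, Nat.card (O y) ≤ Nat.card (O x) := by
    have hbdd : BddAbove ((fun x => Nat.card (O x)) '' J) := by
      refine ⟨Nat.card (Γ ⧸ N), ?_⟩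
      rintro _ ⟨x, -, rfl⟩
      obtain ⟨f, hf⟩ := hOinj x
      exact Nat.card_le_card_of_injective f hf
    obtain ⟨x, hx, hxs⟩ := Nat.sSup_mem (hJne.image _) hbdd
    refine ⟨x, hx, fun y hy => ?_⟩
    have h1 : Nat.card (O x) = _ := hxs
    rw [h1]
    exact le_csSup hbdd ⟨y, hy, rfl⟩
  choose γ hγ using fun y : O x => y.2.1
  replace hγ : ∀ y : O x, γ y • x = y := hγ
  have hV : ∀ y : O x, ∃ V ∈ nhds x, ∀ t ∈ V, γ y • t ∈ J ∧ ((y : ℝ) ≠ x → γ y • t ∉ V) := by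
    intro y
    have hc : Continuous fun t : ℝ => γ y • t := continuous_const_smul (γ y)
    have h1 : (fun t : ℝ => γ y • t) ⁻¹' J ∈ nhds x :=
      hc.continuousAt (hJo.mem_nhds (by rw [hγ]; exact y.2.2))
    by_cases hyx : (y : ℝ) = x
    · exact ⟨_, h1, fun t ht => ⟨ht, fun h => absurd hyx h⟩⟩
    · obtain ⟨A, B, hA, hB, hyA, hxB, hAB⟩ := t2_separation hyx
      refine ⟨(fun t : ℝ => γ y • t) ⁻¹' J ∩ ((fun t : ℝ => γ y • t) ⁻¹' A ∩ B),
        Filter.inter_mem h1 (Filter.inter_mem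
          (hc.continuousAt (hA.mem_nhds (by rwa [hγ]))) (hB.mem_nhds hxB)), ?_⟩
      rintro t ⟨ht1, ht2, -⟩
      exact ⟨ht1, fun _ h => hAB.le_bot ⟨ht2, h.2.2⟩⟩
  choose V hVx hV using hV
  have hall : J ∩ ⋂ y, V y ∈ nhds x :=
    Filter.inter_mem (hJo.mem_nhds hx) (Filter.iInter_mem.mpr hVx)
  obtain ⟨ε, hε, hball⟩ := Metric.mem_nhds_iff.mp hall
  refine ⟨Metric.ball x ε, hball.trans Set.inter_subset_left, Metric.isOpen_ball,
    ⟨x, Metric.mem_ball_self hε⟩, (convex_ball x ε).ordConnected, ?_⟩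
  intro g t ht hgt y hy
  have htJ := (hball ht).1
  -- by maximality, the orbit of `t` meets `J` exactly in the points `γ y • t`
  let F : O x → O t := fun y => ⟨γ y • t, ⟨γ y, rfl⟩, (hV y t (Set.mem_iInter.mp (hball ht).2 y)).1⟩
  have hF : Function.Injective F := by
    intro y z hyz
    have h1 : γ y • t = γ z • t := congrArg Subtype.val hyz
    have h2 := hfix ((γ z)⁻¹ * γ y) t htJ (by rw [mul_smul, h1, inv_smul_smul]) x hx
    rw [mul_smul, inv_smul_eq_iff, hγ, hγ] at h2
    exact Subtype.ext h2
  obtain ⟨z, hz⟩ := (hF.bijective_of_nat_card_le (hmax t htJ)).2 ⟨g • t, ⟨g, rfl⟩, (hball hgt).1⟩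
  have hz' : γ z • t = g • t := congrArg Subtype.val hz
  have hzx : (z : ℝ) = x := by
    by_contra hne
    refine (hV z t (Set.mem_iInter.mp (hball ht).2 z)).2 hne ?_
    rw [hz']
    exact Set.mem_iInter.mp (hball hgt).2 z
  have h1 := hfix (γ z) x hx ((hγ z).trans hzx) t htJ
  exact hfix g t htJ (hz'.symm.trans h1) y (hball hy).1

/-- In a coordinate in which the stabilizer in the normal subgroup acts by translations, the
stabilizer in the whole group acts by affine maps; their slopes are roots of unity, hence the maps
are translations and commute. -/
theorem IsMinimalBlock.of_finiteIndex {J : Set ℝ} (hJo : IsOpen J) (hJne : J.Nonempty)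
    (hJoc : J.OrdConnected) (hJ : IsMinimalBlock N J) : IsMinimalBlock Γ J := by
  have hblock := hJ.isBlockSet_of_normal N hJo hJoc
  refine ⟨hblock, fun x hx => (hJ.dense x hx).trans
    (closure_mono (by rintro _ ⟨g, rfl⟩; exact ⟨g, rfl⟩)), ?_⟩
  obtain ⟨e⟩ := nonempty_homeomorph_real hJo hJne hJoc
  set H := MulAction.stabilizer N J
  have hHmem : ∀ g : H, ∀ x ∈ J, g • x ∈ J := by
    intro g x hx
    have h1 : (g : N) • J = J := g.2
    have h2 : (g : N) • x ∈ (g : N) • J := Set.smul_mem_smul_set hx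
    rwa [h1] at h2
  let S : SubMulAction H ℝ := ⟨J, fun g {x} hx => hHmem g x hx⟩
  have : ContinuousConstSMul H S :=
    ⟨fun g => ((continuous_const_smul g).comp continuous_subtype_val).subtype_mk _⟩
  have hSdense : ∀ y : S, Dense (MulAction.orbit H y) := by
    intro y
    rw [dense_iff_closure_eq, Set.eq_univ_iff_forall]
    intro z
    rw [mem_closure_iff]
    rintro _ ⟨U, hU, rfl⟩ hz
    obtain ⟨_, hg, g, rfl⟩ := mem_closure_iff.mp (hJ.dense y y.2 z.2) (U ∩ J) (hU.inter hJo)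
      ⟨hz, z.2⟩
    exact ⟨(⟨g, hJ.block.smul_eq y.2 hg.2⟩ : H) • y, hg.1, ⟨_, rfl⟩⟩
  obtain ⟨p, τ, hp⟩ := exists_homeomorph_translation (H := H) (Y := S) e
    (fun g h y => Subtype.ext (hJ.smul_comm g h y y.2 (hHmem g y y.2) (hHmem h y y.2))) hSdense
  have hdense := dense_range_of_translation p hSdense ⟨_, hJne.some_mem⟩ hp
  have key : ∀ b : Γ, ∀ hb : ∀ x ∈ J, b • x ∈ J, ∃ s : ℝ, ∀ y : S,
      p ⟨b • (y : ℝ), hb y y.2⟩ = p y + s := by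
    intro b hb
    let bS : S → S := fun y => ⟨b • (y : ℝ), hb y y.2⟩
    have hbS : Continuous bS :=
      ((continuous_const_smul b).comp continuous_subtype_val).subtype_mk _
    let k : ℝ → ℝ := fun t => p (bS (p.symm t))
    have hk : Continuous k := p.continuous.comp (hbS.comp p.symm.continuous)
    have hkp : ∀ y : S, k (p y) = p (bS y) := fun y => by simp only [k, p.symm_apply_apply]
    have haff := eq_affine_of_dense_translations hk hdense (by
      rintro _ ⟨n, rfl⟩
      have hn1 : b * (n : N) * b⁻¹ ∈ N := ‹N.Normal›.conj_mem _ (n : N).2 b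
      have hn2 : ∀ y : ℝ, (⟨_, hn1⟩ : N) • b • y = b • n • y := by
        intro y
        change (b * ((n : N) : Γ) * b⁻¹) • b • y = b • ((n : N) : Γ) • y
        simp only [mul_smul, inv_smul_smul]
      have hy₀ := hJne.some_mem
      have hn3 : (⟨_, hn1⟩ : N) ∈ H := hJ.block.smul_eq (hb _ hy₀) (by
        rw [hn2]
        exact hb _ (hHmem n _ hy₀))
      refine ⟨τ ⟨_, hn3⟩, fun t => ?_⟩
      obtain ⟨y, rfl⟩ := p.surjective t
      rw [← hp n y, hkp, hkp, ← hp]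
      congr 1
      exact Subtype.ext (hn2 y).symm)
    set c := k 1 - k 0 with hc
    have hiter : ∀ (j : ℕ) (t : ℝ), k^[j] t = k^[j] 0 + c ^ j * t := by
      intro j t
      induction j with
      | zero => simp
      | succ j ih =>
        rw [Function.iterate_succ_apply', Function.iterate_succ_apply', ih, haff (_ + _),
          haff (k^[j] 0), pow_succ]
        ring
    have hiterp : ∀ (j : ℕ) (y : S), ∃ z : S, (z : ℝ) = b ^ j • (y : ℝ) ∧ k^[j] (p y) = p z := by
      intro j y
      induction j with
      | zero => exact ⟨y, by simp, rfl⟩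
      | succ j ih =>
        obtain ⟨z, hz, hkz⟩ := ih
        refine ⟨bS z, ?_, by rw [Function.iterate_succ_apply', hkz, hkp]⟩
        rw [pow_succ', mul_smul, ← hz]
    obtain ⟨m, hm0, -, hm⟩ := Subgroup.exists_pow_mem_of_index_ne_zero
      (H := N) Subgroup.FiniteIndex.index_ne_zero b
    have hcm : c ^ m = 1 := by
      have h1 : ∃ s, ∀ y : S, k^[m] (p y) = p y + s := by
        have hmH : (⟨_, hm⟩ : N) ∈ H := by
          obtain ⟨z, hz, -⟩ := hiterp m ⟨_, hJne.some_mem⟩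
          refine hJ.block.smul_eq hJne.some_mem ?_
          change b ^ m • _ ∈ J
          rw [← hz]
          exact z.2
        refine ⟨τ ⟨_, hmH⟩, fun y => ?_⟩
        obtain ⟨z, hz, hkz⟩ := hiterp m y
        rw [hkz, ← hp]
        congr 1
        exact Subtype.ext hz
      obtain ⟨s, hs⟩ := h1
      have h2 : ∀ t, k^[m] t = t + s := fun t => by
        obtain ⟨y, rfl⟩ := p.surjective t
        exact hs y
      have h3 := hiter m 1
      rw [h2, h2] at h3
      linarith
    rcases (pow_eq_one_iff_of_ne_zero hm0.ne').mp hcm with h1 | ⟨h1, -⟩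
    · refine ⟨k 0, fun y => ?_⟩
      change p (bS y) = _
      rw [← hkp, haff, h1]
      ring
    · -- a slope `-1` would make `b` an involution, but a monotone involution is trivial
      exfalso
      have h2 : ∀ y : S, b • (y : ℝ) = y := by
        intro y
        obtain ⟨z, hz, hkz⟩ := hiterp 2 y
        refine pow_smul_eq_self_imp (n := 2) two_pos ?_
        rw [← hz]
        congr 1
        refine p.injective ?_
        rw [← hkz, Function.iterate_succ_apply', Function.iterate_one, haff (k _), haff (p y), h1]
        ring
      have h3 : ∀ t, k t = t := fun t => by
        obtain ⟨y, rfl⟩ := p.surjective t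
        rw [hkp]
        congr 1
        exact Subtype.ext (h2 y)
      rw [hc, h3, h3] at h1
      norm_num at h1
  intro g h x hx hgx hhx
  have hg : ∀ y ∈ J, g • y ∈ J := hblock g x hx hgx
  have hh : ∀ y ∈ J, h • y ∈ J := hblock h x hx hhx
  obtain ⟨s, hs⟩ := key g hg
  obtain ⟨t, ht⟩ := key h hh
  have h1 := hs ⟨h • x, hhx⟩
  have h2 := ht ⟨g • x, hgx⟩
  have h3 := hs ⟨x, hx⟩
  have h4 := ht ⟨x, hx⟩
  have h5 := p.injective (h1.trans ((by rw [h4, h3]; ring : _ = _).trans h2.symm))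
  exact congrArg Subtype.val h5

end finiteIndex

/-- Every nonempty invariant open subset of the line contains an open interval that is wandering or a
minimal block. -/
theorem exists_wandering_or_minimalBlock {n : ℕ} {Γ : Type u} [Group Γ] [MulAction Γ ℝ]
    [IsMonotoneAction Γ ℝ] (hΓ : HirschLengthLE n Γ) (hvn : Group.IsVirtuallyNilpotent Γ)
    {W : Set ℝ} (hWo : IsOpen W) (hWne : W.Nonempty) (hinv : ∀ g : Γ, ∀ x ∈ W, g • x ∈ W) :
    ∃ J ⊆ W, IsOpen J ∧ J.Nonempty ∧ J.OrdConnected ∧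
      (IsWanderingSet Γ J ∨ IsMinimalBlock Γ J) := by
  obtain ⟨N₀, hN₀, hfi⟩ := hvn
  set N := N₀.normalCore
  have hN : Group.IsNilpotent N :=
    Group.nilpotent_of_mulEquiv (Subgroup.subgroupOfEquivOfLe N₀.normalCore_le)
  obtain ⟨x, hx⟩ := hWne
  set K := connectedComponentIn W x
  have hKb : IsBlockSet N K := isBlockSet_connectedComponentIn (Γ := N) (fun g => hinv g) x
  have hHmem : ∀ g : MulAction.stabilizer N K, ∀ y ∈ K, g • y ∈ K := by
    intro g y hy
    have h1 : (g : N) • K = K := g.2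
    have h2 : (g : N) • y ∈ (g : N) • K := Set.smul_mem_smul_set hy
    rwa [h1] at h2
  obtain ⟨J, hJK, hJo, hJne, hJoc, hJ⟩ := exists_wandering_or_minimalBlock_of_isNilpotent n
    (MulAction.stabilizer N K) ((hΓ.subgroup N).subgroup _) K
    isPreconnected_connectedComponentIn.ordConnected hWo.connectedComponentIn
    ⟨x, mem_connectedComponentIn hx⟩ hHmem
  have hJW := hJK.trans (connectedComponentIn_subset W x)
  rcases hJ with hJ | hJ
  · obtain ⟨J', hJ', h1, h2, h3, h4⟩ :=
      IsWanderingSet.exists_of_finiteIndex N hJo hJne (.of_stabilizer hKb hJK hJ)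
    exact ⟨J', hJ'.trans hJW, h1, h2, h3, .inl h4⟩
  · exact ⟨J, hJW, hJo, hJne, hJoc,
      .inr ((IsMinimalBlock.of_stabilizer hKb hJK hJ).of_finiteIndex N hJo hJne hJoc)⟩

/-! ### Interval decompositions from wandering intervals and minimal blocks -/

section decomposition

variable {M : Type*} [TopologicalSpace M] {G : Type*} [Group G]

/-- The action on the manifold itself given by a homomorphism to its homeomorphism group. -/
abbrev toMulAction (φ : G →* HomeoPlus M) : MulAction G M where
  smul g x := (φ g : M ≃ₜ M) x
  one_smul x := by
    change (φ 1 : M ≃ₜ M) x = x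
    rw [map_one]
    rfl
  mul_smul g h x := by
    change (φ (g * h) : M ≃ₜ M) x = (φ g : M ≃ₜ M) ((φ h : M ≃ₜ M) x)
    rw [map_mul]
    rfl

/-- The conditions that an interval decomposition imposes on one of the sets `I_i`. -/
structure IsWanderingPiece (φ : G →* HomeoPlus M) (U : Set M) : Prop where
  isOpen : IsOpen U
  nonempty : U.Nonempty
  invariant : ∀ g : G, Stabilizes φ U g
  interval : ∀ K ∈ components U, IsOpenInterval K
  transitive : ∀ K ∈ components U, ∀ K' ∈ components U, ∃ g : G, (φ g : M ≃ₜ M) '' K = K'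
  trivial : ∀ K ∈ components U, ∀ g : G, Stabilizes φ K g → ∀ x ∈ K, (φ g : M ≃ₜ M) x = x

/-- The conditions that an interval decomposition imposes on one of the sets `M_i`. -/
structure IsMinimalPiece (φ : G →* HomeoPlus M) (V : Set M) : Prop where
  isOpen : IsOpen V
  nonempty : V.Nonempty
  invariant : ∀ g : G, Stabilizes φ V g
  interval : (∀ K ∈ components V, IsOpenInterval K) ∨
    (V = Set.univ ∧ Nonempty (M ≃ₜ UnitAddCircle))
  minimal : ∀ x ∈ V, V ⊆ closure {y | ∃ g : G, (φ g : M ≃ₜ M) x = y}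
  abelian : ∀ K ∈ components V, ∀ g h : G, Stabilizes φ K g → Stabilizes φ K h →
    ∀ x ∈ K, (φ g : M ≃ₜ M) ((φ h : M ≃ₜ M) x) = (φ h : M ≃ₜ M) ((φ g : M ≃ₜ M) x)

/-- A maximal disjoint family of pieces is an interval decomposition if every invariant open set
contains a piece. -/
theorem exists_isIntervalDecomposition_of_pieces [TopologicalSpace.SeparableSpace M]
    (φ : G →* HomeoPlus M)
    (h : ∀ W : Set M, IsOpen W → W.Nonempty → (∀ g : G, ∀ x ∈ W, (φ g : M ≃ₜ M) x ∈ W) →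
      ∃ V ⊆ W, IsWanderingPiece φ V ∨ IsMinimalPiece φ V) :
    ∃ 𝓘 𝓜 : Set (Set M), IsIntervalDecomposition φ 𝓘 𝓜 := by
  obtain ⟨𝓕, h𝓕⟩ := zorn_subset {𝓕 : Set (Set M) | (∀ V ∈ 𝓕, IsWanderingPiece φ V ∨
      IsMinimalPiece φ V) ∧ 𝓕.PairwiseDisjoint id} (by
    intro c hc hchain
    refine ⟨⋃₀ c, ⟨?_, ?_⟩, fun s hs => Set.subset_sUnion_of_mem hs⟩
    · rintro V ⟨𝓕, h𝓕, hV⟩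
      exact (hc h𝓕).1 V hV
    · exact (Set.pairwiseDisjoint_sUnion hchain.directedOn).mpr fun 𝓕 h𝓕 => (hc h𝓕).2)
  have hopen : ∀ V ∈ 𝓕, IsOpen V := fun V hV =>
    (h𝓕.prop.1 V hV).elim (fun h => h.isOpen) fun h => h.isOpen
  have hne : ∀ V ∈ 𝓕, V.Nonempty := fun V hV =>
    (h𝓕.prop.1 V hV).elim (fun h => h.nonempty) fun h => h.nonempty
  have hinv : ∀ V ∈ 𝓕, ∀ g : G, Stabilizes φ V g := fun V hV =>
    (h𝓕.prop.1 V hV).elim (fun h => h.invariant) fun h => h.invariant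
  have hdense : Dense (⋃₀ 𝓕) := by
    by_contra hnd
    rw [dense_iff_closure_eq, ← Ne, ← Set.nonempty_compl] at hnd
    obtain ⟨V, hVW, hV⟩ := h (closure (⋃₀ 𝓕))ᶜ isClosed_closure.isOpen_compl hnd (by
      intro g x hx hgx
      refine hx ?_
      have h1 : x = (φ g : M ≃ₜ M).symm ((φ g : M ≃ₜ M) x) :=
        ((φ g : M ≃ₜ M).symm_apply_apply x).symm
      rw [h1]
      refine map_mem_closure (φ g : M ≃ₜ M).symm.continuous hgx ?_
      rintro y ⟨V, hV, hy⟩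
      refine ⟨V, hV, ?_⟩
      have h2 : (φ g : M ≃ₜ M) '' V = V := hinv V hV g
      rw [← h2] at hy
      obtain ⟨z, hz, rfl⟩ := hy
      rwa [Homeomorph.symm_apply_apply])
    have hdisj : ∀ U ∈ 𝓕, Disjoint V U := fun U hU => by
      refine Set.disjoint_of_subset hVW ?_ disjoint_compl_left
      exact (Set.subset_sUnion_of_mem hU).trans subset_closure
    have hmem : V ∈ 𝓕 := h𝓕.le_of_ge (y := insert V 𝓕)
      ⟨by rintro U (rfl | hU); exacts [hV, h𝓕.prop.1 U hU],
        h𝓕.prop.2.insert fun U hU _ => hdisj U hU⟩ (Set.subset_insert _ _) (Set.mem_insert _ _)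
    exact (hne V hmem).ne_empty (disjoint_self.mp (hdisj V hmem))
  have hcount : 𝓕.Countable := h𝓕.prop.2.countable_of_isOpen hopen hne
  have hdis : ∀ U ∈ 𝓕, ∀ V ∈ 𝓕, U ≠ V → Disjoint U V := fun U hU V hV hUV =>
    h𝓕.prop.2 hU hV hUV
  have hsub : {V ∈ 𝓕 | IsWanderingPiece φ V} ∪ {V ∈ 𝓕 | ¬ IsWanderingPiece φ V} = 𝓕 := by
    ext V
    simp only [Set.mem_union, Set.mem_sep_iff]
    tauto
  have hmin : ∀ V ∈ {V ∈ 𝓕 | ¬ IsWanderingPiece φ V}, IsMinimalPiece φ V := fun V hV =>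
    (h𝓕.prop.1 V hV.1).resolve_left hV.2
  refine ⟨{V ∈ 𝓕 | IsWanderingPiece φ V}, {V ∈ 𝓕 | ¬ IsWanderingPiece φ V}, ?_⟩
  exact
    { countable := by rwa [hsub]
      isOpen := by rwa [hsub]
      nonempty := by rwa [hsub]
      disjoint_I := fun U hU V hV => hdis U hU.1 V hV.1
      disjoint_M := fun U hU V hV => hdis U hU.1 V hV.1
      disjoint_I_M := fun U hU V hV => hdis U hU.1 V hV.1 fun h => hV.2 (h ▸ hU.2)
      invariant := by rwa [hsub]
      interval_I := fun U hU => hU.2.interval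
      transitive := fun U hU => hU.2.transitive
      trivial := fun U hU => hU.2.trivial
      interval_M := fun V hV => (hmin V hV).interval
      minimal := fun V hV => (hmin V hV).minimal
      abelian := fun V hV => (hmin V hV).abelian
      dense := by rwa [← Set.sUnion_union, hsub] }

theorem IsOpenInterval.nonempty {K : Set M} (hK : IsOpenInterval K) : K.Nonempty := by
  obtain ⟨e⟩ := hK.2
  exact ⟨e.symm 0, (e.symm 0).2⟩

theorem IsOpenInterval.isPreconnected {K : Set M} (hK : IsOpenInterval K) : IsPreconnected K := by
  obtain ⟨e⟩ := hK.2
  rw [isPreconnected_iff_preconnectedSpace]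
  exact e.symm.surjective.denseRange.preconnectedSpace e.symm.continuous

theorem IsOpenInterval.image {K : Set M} (hK : IsOpenInterval K) (f : M ≃ₜ M) :
    IsOpenInterval (f '' K) :=
  ⟨f.isOpenMap K hK.1, hK.2.map fun e => (f.image K).symm.trans e⟩

/-- The connected components of the union of the translates of a block are these translates. -/
theorem connectedComponentIn_iUnion_smul {X : Type*} [TopologicalSpace X] [MulAction G X]
    [ContinuousConstSMul G X] {J : Set X} (hJo : IsOpen J) (hJp : IsPreconnected J)
    (hJ : IsBlockSet G J) (g : G) {x : X} (hx : x ∈ g • J) :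
    connectedComponentIn (⋃ k : G, k • J) x = g • J := by
  refine Set.Subset.antisymm ?_ ((hJp.image _
    (continuous_const_smul g).continuousOn).subset_connectedComponentIn hx
      (Set.subset_iUnion (fun k : G => k • J) g))
  have hxU : x ∈ ⋃ k : G, k • J := Set.mem_iUnion.mpr ⟨g, hx⟩
  refine IsPreconnected.subset_left_of_subset_union (hJo.smul g)
    (v := ⋃ (k : G) (_ : k • J ≠ g • J), k • J)
    (isOpen_iUnion fun k => isOpen_iUnion fun _ => hJo.smul k) ?_ ?_
    ⟨x, mem_connectedComponentIn hxU, hx⟩ isPreconnected_connectedComponentIn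
  · rw [Set.disjoint_left]
    intro y hy hy'
    obtain ⟨k, hk, hyk⟩ := Set.mem_iUnion₂.mp hy'
    rw [Set.mem_smul_set_iff_inv_smul_mem] at hy hyk
    have h1 : (g⁻¹ * k) • J = J := hJ.smul_eq hyk (by rwa [mul_smul, smul_inv_smul])
    rw [mul_smul, inv_smul_eq_iff] at h1
    exact hk h1
  · refine (connectedComponentIn_subset _ _).trans fun y hy => ?_
    obtain ⟨k, hk⟩ := Set.mem_iUnion.mp hy
    by_cases hkg : k • J = g • J
    · exact .inl (hkg ▸ hk)
    · exact .inr (Set.mem_iUnion₂.mpr ⟨k, hkg, hk⟩)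

/-- The union of the translates of a wandering interval satisfies the conditions on an `I_i`, and that
of the translates of a minimal block the conditions on an `M_i`. -/
theorem exists_isIntervalDecomposition_of_blocks [TopologicalSpace.SeparableSpace M]
    (φ : G →* HomeoPlus M)
    (h : let _ := toMulAction φ
      ∀ W : Set M, IsOpen W → W.Nonempty → (∀ g : G, ∀ x ∈ W, (φ g : M ≃ₜ M) x ∈ W) →
      (∃ J ⊆ W, IsOpenInterval J ∧ (IsWanderingSet G J ∨ IsMinimalBlock G J)) ∨
      (W = Set.univ ∧ Nonempty (M ≃ₜ UnitAddCircle) ∧ IsMinimalBlock G (Set.univ : Set M))) :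
    ∃ 𝓘 𝓜 : Set (Set M), IsIntervalDecomposition φ 𝓘 𝓜 := by
  let _ := toMulAction φ
  have : ContinuousConstSMul G M := ⟨fun g => (φ g : M ≃ₜ M).continuous⟩
  refine exists_isIntervalDecomposition_of_pieces φ fun W hWo hWne hWinv => ?_
  have himage : ∀ (g : G) (K : Set M), (φ g : M ≃ₜ M) '' K = g • K := fun _ _ => rfl
  rcases h W hWo hWne hWinv with ⟨J, hJW, hJi, hJ⟩ | ⟨rfl, hcirc, hmin⟩
  · have hJb : IsBlockSet G J := hJ.elim (fun h => h.block) fun h => h.block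
    set U := ⋃ k : G, k • J with hU
    have hcomp : ∀ K, K ∈ components U ↔ ∃ g : G, K = g • J := by
      intro K
      constructor
      · rintro ⟨x, hx, rfl⟩
        obtain ⟨g, hg⟩ := Set.mem_iUnion.mp hx
        exact ⟨g, connectedComponentIn_iUnion_smul hJi.1 hJi.isPreconnected hJb g hg⟩
      · rintro ⟨g, rfl⟩
        obtain ⟨x, hx⟩ := hJi.nonempty
        have hgx := Set.smul_mem_smul_set (a := g) hx
        exact ⟨g • x, Set.mem_iUnion.mpr ⟨g, hgx⟩,
          (connectedComponentIn_iUnion_smul hJi.1 hJi.isPreconnected hJb g hgx).symm⟩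
    have hUW : U ⊆ W := by
      refine Set.iUnion_subset fun g => ?_
      rintro _ ⟨x, hx, rfl⟩
      exact hWinv g x (hJW hx)
    have hUo : IsOpen U := isOpen_iUnion fun g => hJi.1.smul g
    have hUne : U.Nonempty := by
      obtain ⟨x, hx⟩ := hJi.nonempty
      exact ⟨(1 : G) • x, Set.mem_iUnion.mpr ⟨1, Set.smul_mem_smul_set hx⟩⟩
    have hUinv : ∀ g : G, Stabilizes φ U g := by
      intro g
      change g • U = U
      rw [hU, Set.smul_set_iUnion]
      simp only [← mul_smul]
      exact (Equiv.mulLeft g).surjective.iUnion_comp (fun k : G => k • J)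
    have hUint : ∀ K ∈ components U, IsOpenInterval K := by
      intro K hK
      obtain ⟨g, rfl⟩ := (hcomp K).mp hK
      exact hJi.image (φ g : M ≃ₜ M)
    have hconj : ∀ (g k : G), Stabilizes φ (g • J) k → (g⁻¹ * k * g) • J = J := by
      intro g k hk
      have hk' : k • g • J = g • J := hk
      rw [mul_smul, mul_smul, hk', inv_smul_smul]
    have hmem : ∀ (k : G) {x : M}, x ∈ J → k • J = J → k • x ∈ J := by
      intro k x hx hk
      have h1 := Set.smul_mem_smul_set (a := k) hx
      rwa [hk] at h1
    refine ⟨U, hUW, ?_⟩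
    rcases hJ with hJ | hJ
    · left
      refine ⟨hUo, hUne, hUinv, hUint, ?_, ?_⟩
      · intro K hK K' hK'
        obtain ⟨g, rfl⟩ := (hcomp K).mp hK
        obtain ⟨k, rfl⟩ := (hcomp K').mp hK'
        refine ⟨k * g⁻¹, ?_⟩
        rw [himage, mul_smul, inv_smul_smul]
      · intro K hK k hk x hx
        obtain ⟨g, rfl⟩ := (hcomp K).mp hK
        obtain ⟨y, hy, rfl⟩ := hx
        have h1 := hJ (g⁻¹ * k * g) y hy (hmem _ hy (hconj g k hk)) y hy
        rw [mul_smul, mul_smul, inv_smul_eq_iff] at h1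
        exact h1
    · right
      refine ⟨hUo, hUne, hUinv, .inl hUint, ?_, ?_⟩
      · intro x hx y hy
        obtain ⟨g, a, ha, rfl⟩ := Set.mem_iUnion.mp hx
        obtain ⟨k, b, hb, rfl⟩ := Set.mem_iUnion.mp hy
        refine map_mem_closure (continuous_const_smul k) (hJ.dense a ha hb) ?_
        rintro _ ⟨l, rfl⟩
        refine ⟨k * l * g⁻¹, ?_⟩
        change (k * l * g⁻¹) • g • a = k • l • a
        simp only [mul_smul, inv_smul_smul]
      · intro K hK k l hk hl x hx
        obtain ⟨g, rfl⟩ := (hcomp K).mp hK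
        obtain ⟨y, hy, rfl⟩ := hx
        have h1 := hJ.smul_comm _ _ y hy (hmem _ hy (hconj g k hk)) (hmem _ hy (hconj g l hl))
        simp only [mul_smul, smul_inv_smul] at h1
        exact MulAction.injective g⁻¹ h1
  · exact ⟨Set.univ, subset_rfl, .inr ⟨isOpen_univ, hWne,
      fun g => Set.image_univ_of_surjective (φ g : M ≃ₜ M).surjective, .inr ⟨rfl, hcirc⟩,
      fun x hx => hmin.dense x hx, fun _ _ g h _ _ x _ => hmin.smul_comm g h x trivial trivial
        trivial⟩⟩

end decomposition

/-! ### Existence of interval decompositions: line and intervals -/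

section extend

variable {M : Type v} {G : Type u} [Group G]

open Classical in
/-- The extension by the identity of a self-map of a space that is embedded in the line by `f`. -/
noncomputable def extendFun (f : M → ℝ) (σ : M → M) (t : ℝ) : ℝ :=
  if h : t ∈ Set.range f then f (σ h.choose) else t

theorem extendFun_apply {f : M → ℝ} (hf : Function.Injective f) (σ : M → M) (x : M) :
    extendFun f σ (f x) = f (σ x) := by
  have h : f x ∈ Set.range f := ⟨x, rfl⟩
  refine (dif_pos h).trans ?_
  rw [hf h.choose_spec]

theorem extendFun_of_notMem {f : M → ℝ} (σ : M → M) {t : ℝ} (ht : t ∉ Set.range f) :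
    extendFun f σ t = t :=
  dif_neg ht

/-- The extension by the identity of an action on a space that is embedded in the line by `f`. -/
noncomputable abbrev extendMulAction [MulAction G M] {f : M → ℝ} (hf : Function.Injective f) :
    MulAction G ℝ where
  smul g := extendFun f (g • ·)
  one_smul t := by
    change extendFun f _ t = t
    by_cases h : t ∈ Set.range f
    · obtain ⟨x, rfl⟩ := h
      rw [extendFun_apply hf, one_smul]
    · exact extendFun_of_notMem _ h
  mul_smul g k t := by
    change extendFun f _ t = extendFun f _ (extendFun f _ t)
    by_cases h : t ∈ Set.range f
    · obtain ⟨x, rfl⟩ := h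
      rw [extendFun_apply hf, extendFun_apply hf, extendFun_apply hf, mul_smul]
    · rw [extendFun_of_notMem _ h, extendFun_of_notMem _ h, extendFun_of_notMem _ h]

end extend

section line

variable {M : Type v} [TopologicalSpace M] {G : Type u} [Group G]

/-- Wandering intervals and minimal blocks for an action on a space that is embedded in the line as
an interval are found by extending the action to the line. -/
theorem exists_block_of_isEmbedding [Group.FG G] (hG : Group.IsVirtuallyNilpotent G)
    [MulAction G M] {f : M → ℝ} (hf : Topology.IsEmbedding f) (hoc : (Set.range f).OrdConnected)
    (hint : Set.range f ⊆ closure (interior (Set.range f)))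
    (hmono : ∀ (g : G) (x y : M), f x < f y → f (g • x) < f (g • y)) {W : Set M} (hWo : IsOpen W)
    (hWne : W.Nonempty) (hWinv : ∀ g : G, ∀ x ∈ W, g • x ∈ W) :
    ∃ J ⊆ W, IsOpenInterval J ∧ (IsWanderingSet G J ∨ IsMinimalBlock G J) := by
  let _ : MulAction G ℝ := extendMulAction hf.injective
  have hsmul : ∀ (g : G) (x : M), g • f x = f (g • x) := fun g x => extendFun_apply hf.injective (g • ·) x
  have hsmul' : ∀ (g : G) (t : ℝ), t ∉ Set.range f → g • t = t := fun g t ht =>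
    extendFun_of_notMem (g • ·) ht
  have hmono' : IsMonotoneAction G ℝ := by
    refine ⟨fun g s t hst => ?_⟩
    by_cases hs : s ∈ Set.range f <;> by_cases ht : t ∈ Set.range f
    · obtain ⟨x, rfl⟩ := hs
      obtain ⟨y, rfl⟩ := ht
      rw [hsmul, hsmul]
      rcases hst.eq_or_lt with h | h
      · rw [hf.injective h]
      · exact (hmono g x y h).le
    · obtain ⟨x, rfl⟩ := hs
      rw [hsmul, hsmul' g t ht]
      by_contra hcon
      exact ht (hoc.out ⟨x, rfl⟩ ⟨g • x, rfl⟩ ⟨hst, (not_le.mp hcon).le⟩)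
    · obtain ⟨y, rfl⟩ := ht
      rw [hsmul, hsmul' g s hs]
      by_contra hcon
      exact hs (hoc.out ⟨g • y, rfl⟩ ⟨y, rfl⟩ ⟨(not_le.mp hcon).le, hst⟩)
    · rwa [hsmul' g s hs, hsmul' g t ht]
  obtain ⟨n, hn⟩ := exists_hirschLengthLE_of_isVirtuallyNilpotent hG
  obtain ⟨O, hO, hOW⟩ := hf.isOpen_iff.mp hWo
  have hW' : ∀ x : M, f x ∈ O ↔ x ∈ W := fun x => by rw [← hOW]; rfl
  obtain ⟨J, hJW, hJo, hJne, hJoc, hJ⟩ := exists_wandering_or_minimalBlock hn hG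
    (W := O ∩ interior (Set.range f)) (hO.inter isOpen_interior) (by
      obtain ⟨x, hx⟩ := hWne
      exact mem_closure_iff.mp (hint ⟨x, rfl⟩) O hO ((hW' x).mpr hx)) (by
      rintro g t ⟨ht1, ht2⟩
      obtain ⟨x, rfl⟩ := interior_subset ht2
      refine ⟨?_, ?_⟩
      · rw [hsmul, hW']
        exact hWinv g x ((hW' x).mp ht1)
      · have h1 : g • interior (Set.range f) ⊆ interior (Set.range f) := by
          refine interior_maximal ?_ (isOpen_interior.smul g)
          rintro _ ⟨t, ht, rfl⟩
          obtain ⟨y, rfl⟩ := interior_subset ht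
          exact ⟨g • y, (hsmul g y).symm⟩
        exact h1 (Set.smul_mem_smul_set ht2))
  have hJrange : J ⊆ Set.range f := fun t ht => interior_subset (hJW ht).2
  have himage : f '' (f ⁻¹' J) = J := Set.image_preimage_eq_of_subset hJrange
  refine ⟨f ⁻¹' J, fun x hx => (hW' x).mp (hJW hx).1, ⟨hJo.preimage hf.continuous, ?_⟩, ?_⟩
  · obtain ⟨e⟩ := nonempty_homeomorph_real hJo hJne hJoc
    exact ⟨(hf.homeomorphImage (f ⁻¹' J)).trans ((Homeomorph.setCongr himage).trans e)⟩
  · rcases hJ with hJ | hJ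
    · left
      intro g x hx hgx y hy
      refine hf.injective ?_
      rw [← hsmul]
      exact hJ g (f x) hx (by rw [hsmul]; exact hgx) (f y) hy
    · right
      refine ⟨?_, ?_, ?_⟩
      · intro g x hx hgx y hy
        change f (g • y) ∈ J
        rw [← hsmul]
        exact hJ.block g (f x) hx (by rw [hsmul]; exact hgx) (f y) hy
      · intro x hx y hy
        rw [hf.isInducing.closure_eq_preimage_closure_image]
        have h1 := hJ.dense (f x) hx hy
        refine closure_mono ?_ h1
        rintro _ ⟨g, rfl⟩
        exact ⟨g • x, ⟨g, rfl⟩, (hsmul g x).symm⟩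
      · intro g k x hx hgx hkx
        refine hf.injective ?_
        have h1 := hJ.smul_comm g k (f x) hx (by rw [hsmul]; exact hgx) (by rw [hsmul]; exact hkx)
        simpa only [hsmul] using h1

end line

/-! ### Existence of interval decompositions: the circle -/

section circle

variable {M : Type v} {G : Type u} [Group G] [MulAction G M]

variable (G) in
/-- The group of lifts of the elements of `G` along a map `π` from the line: pairs of a group
element and an increasing bijection of the line that covers its action. -/
def liftGroup (π : ℝ → M) : Subgroup (G × (ℝ ≃o ℝ)) where
  carrier := {p | ∀ t, p.1 • π t = π (p.2 t)}
  one_mem' t := one_smul G (π t)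
  mul_mem' {p q} hp hq t := by
    change (p.1 * q.1) • π t = π (p.2 (q.2 t))
    rw [mul_smul, hq t, hp]
  inv_mem' {p} hp t := by
    change p.1⁻¹ • π t = π (p.2.symm t)
    rw [inv_smul_eq_iff, hp, OrderIso.apply_symm_apply]

/-- The group of lifts acts on the line. -/
abbrev liftGroup.mulAction (π : ℝ → M) : MulAction (liftGroup G π) ℝ where
  smul p t := p.1.2 t
  one_smul _ := rfl
  mul_smul _ _ _ := rfl

/-- The projection from the group of lifts. -/
def liftGroup.proj (π : ℝ → M) : liftGroup G π →* G :=
  (MonoidHom.fst G (ℝ ≃o ℝ)).comp (liftGroup G π).subtype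

/-- Lifts of homeomorphisms commute with the integer translations. -/
theorem lift_add_int {π : ℝ → M} (hπ : ∀ s t, π s = π t ↔ ∃ n : ℤ, t = s + n)
    {p : G × (ℝ ≃o ℝ)} (hp : p ∈ liftGroup G π) (t : ℝ) (n : ℤ) : p.2 (t + n) = p.2 t + n := by
  have h1 : Function.Periodic (fun t => p.2 t - t) 1 := by
    intro t
    have h2 : π (p.2 t) = π (p.2 (t + 1)) := by
      rw [← hp t, ← hp (t + 1), (hπ t (t + 1)).mpr ⟨1, by simp⟩]
    obtain ⟨m, hm⟩ := (hπ _ _).mp h2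
    have hm1 : 0 < m := by
      have h3 : p.2 t < p.2 (t + 1) := p.2.lt_iff_lt.mpr (lt_add_one t)
      rw [hm] at h3
      exact_mod_cast (by linarith : (0 : ℝ) < m)
    -- if the degree `m` were at least `2`, two points at distance less than `1` would have images
    -- at distance `1`
    have hm2 : m ≤ 1 := by
      by_contra hcon
      have hm3 : (2 : ℝ) ≤ m := by exact_mod_cast (by omega : 2 ≤ m)
      obtain ⟨s, hs⟩ := p.2.surjective (p.2 t + 1)
      have hts : t < s := p.2.lt_iff_lt.mp (by rw [hs]; linarith)
      have hst : s < t + 1 := p.2.lt_iff_lt.mp (by rw [hs, hm]; linarith)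
      have h4 : p.1 • π t = p.1 • π s := by
        rw [hp, hp, hs]
        exact (hπ _ _).mpr ⟨1, by simp⟩
      obtain ⟨k, rfl⟩ := (hπ t s).mp (MulAction.injective _ h4)
      have h5 : 0 < k := by exact_mod_cast (by linarith : (0 : ℝ) < k)
      have h6 : k < 1 := by exact_mod_cast (by linarith : (k : ℝ) < 1)
      omega
    obtain rfl : m = 1 := by omega
    change p.2 (t + 1) - (t + 1) = p.2 t - t
    rw [hm]
    push_cast
    ring
  have h2 := h1.int_mul n t
  change p.2 (t + n * 1) - (t + n * 1) = p.2 t - t at h2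
  rw [mul_one] at h2
  linarith

/-- Lifts of the identity are integer translations. -/
theorem exists_int_of_proj_eq_one {π : ℝ → M} (hπ : ∀ s t, π s = π t ↔ ∃ n : ℤ, t = s + n)
    {p : G × (ℝ ≃o ℝ)} (hp : p ∈ liftGroup G π) (hp1 : p.1 = 1) :
    ∃ n : ℤ, ∀ t, p.2 t = t + n := by
  have h1 : ∀ t, ∃ n : ℤ, p.2 t = t + n := by
    intro t
    have h2 := hp t
    rw [hp1, one_smul] at h2
    exact (hπ _ _).mp h2
  choose n hn using h1
  have h2 : ∀ t, n t = n 0 := by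
    have hc : Continuous fun t => ((n t : ℤ) : ℝ) := by
      have : (fun t => ((n t : ℤ) : ℝ)) = fun t => p.2 t - t := by
        funext t
        rw [hn]
        ring
      rw [this]
      exact p.2.continuous.sub continuous_id
    have hc' : Continuous n := Int.isClosedEmbedding_coe_real.isInducing.continuous_iff.mpr hc
    exact fun t => PreconnectedSpace.constant inferInstance hc'
  exact ⟨n 0, fun t => by rw [hn, h2]⟩

/-- The translation by an integer, as a lift of the identity. -/
def liftGroup.translation {π : ℝ → M} (hπ : ∀ s t, π s = π t ↔ ∃ n : ℤ, t = s + n) (n : ℤ) :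
    liftGroup G π :=
  ⟨(1, OrderIso.addRight (n : ℝ)), fun t => by
    rw [one_smul]
    exact (hπ _ _).mpr ⟨n, rfl⟩⟩

theorem liftGroup.ker_proj_le_center {π : ℝ → M} (hπ : ∀ s t, π s = π t ↔ ∃ n : ℤ, t = s + n) :
    (liftGroup.proj (G := G) π).ker ≤ Subgroup.center _ := by
  intro p hp
  obtain ⟨n, hn⟩ := exists_int_of_proj_eq_one hπ p.2 hp
  rw [Subgroup.mem_center_iff]
  intro q
  refine Subtype.ext (Prod.ext ?_ ?_)
  · change q.1.1 * p.1.1 = p.1.1 * q.1.1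
    rw [show p.1.1 = 1 from hp, one_mul, mul_one]
  · refine RelIso.ext fun t => ?_
    change q.1.2 (p.1.2 t) = p.1.2 (q.1.2 t)
    rw [hn, hn, lift_add_int hπ q.2]

theorem liftGroup.hirschLengthLE_ker_proj {π : ℝ → M}
    (hπ : ∀ s t, π s = π t ↔ ∃ n : ℤ, t = s + n) :
    HirschLengthLE 1 (liftGroup.proj (G := G) π).ker := by
  choose n hn using fun p : (liftGroup.proj (G := G) π).ker =>
    exists_int_of_proj_eq_one hπ p.1.2 p.2
  let f : (liftGroup.proj (G := G) π).ker →* Multiplicative ℤ := MonoidHom.mk'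
    (fun p => Multiplicative.ofAdd (n p)) (by
      intro p q
      rw [← ofAdd_add]
      congr 1
      have h1 : (p * q).1.1.2 0 = p.1.1.2 (q.1.1.2 0) := rfl
      rw [hn, hn, hn] at h1
      have h2 : ((n (p * q) : ℤ) : ℝ) = n p + n q := by linarith
      exact_mod_cast h2)
  refine .of_injective f (fun p q hpq => ?_) hirschLengthLE_one_of_isCyclic
  have h1 : n p = n q := Multiplicative.ofAdd.injective hpq
  refine Subtype.ext (Subtype.ext (Prod.ext ?_ ?_))
  · exact (show p.1.1.1 = 1 from p.2).trans (show q.1.1.1 = 1 from q.2).symm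
  · refine RelIso.ext fun t => ?_
    rw [hn, hn, h1]

theorem liftGroup.isVirtuallyNilpotent {π : ℝ → M}
    (hπ : ∀ s t, π s = π t ↔ ∃ n : ℤ, t = s + n) (hG : Group.IsVirtuallyNilpotent G) :
    Group.IsVirtuallyNilpotent (liftGroup G π) := by
  obtain ⟨N, hN, hfi⟩ := hG
  refine ⟨N.comap (liftGroup.proj π), ?_, finiteIndex_comap _ N⟩
  refine Subgroup.isNilpotent_of_ker_le_center ((liftGroup.proj π).subgroupComap N) ?_
  intro p hp
  have h1 : (p : liftGroup G π) ∈ (liftGroup.proj (G := G) π).ker :=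
    congrArg Subtype.val (show (liftGroup.proj π).subgroupComap N p = 1 from hp)
  have h2 := Subgroup.mem_center_iff.mp (liftGroup.ker_proj_le_center hπ h1)
  exact Subgroup.mem_center_iff.mpr fun q => Subtype.ext (h2 q)

/-- Wandering intervals and minimal blocks for an action on the circle are found by lifting it to
an action of a central extension by the integers on the line. -/
theorem exists_block_of_covering [TopologicalSpace M] [Group.FG G]
    (hG : Group.IsVirtuallyNilpotent G) {π : ℝ → M}
    (hπ : ∀ s t, π s = π t ↔ ∃ n : ℤ, t = s + n) (hπc : Continuous π) (hπo : IsOpenMap π)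
    (hπs : Function.Surjective π) (hlift : ∀ g : G, ∃ F : ℝ ≃o ℝ, ∀ t, g • π t = π (F t))
    {W : Set M} (hWo : IsOpen W) (hWne : W.Nonempty) (hWinv : ∀ g : G, ∀ x ∈ W, g • x ∈ W) :
    (∃ J ⊆ W, IsOpenInterval J ∧ (IsWanderingSet G J ∨ IsMinimalBlock G J)) ∨
      (W = Set.univ ∧ IsMinimalBlock G (Set.univ : Set M)) := by
  let _ : MulAction (liftGroup G π) ℝ := liftGroup.mulAction π
  have hsmul : ∀ (p : liftGroup G π) (t : ℝ), p.1.1 • π t = π (p • t) := fun p t => p.2 t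
  have : IsMonotoneAction (liftGroup G π) ℝ := ⟨fun p _ _ h => p.1.2.monotone h⟩
  obtain ⟨n, hn⟩ := exists_hirschLengthLE_of_isVirtuallyNilpotent hG
  obtain ⟨J, hJW, hJo, hJne, hJoc, hJ⟩ := exists_wandering_or_minimalBlock
    (HirschLengthLE.of_extension (liftGroup.proj (G := G) π)
      (liftGroup.hirschLengthLE_ker_proj hπ) hn) (liftGroup.isVirtuallyNilpotent hπ hG)
    (W := π ⁻¹' W) (hWo.preimage hπc) (by
      obtain ⟨x, hx⟩ := hWne
      obtain ⟨t, rfl⟩ := hπs x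
      exact ⟨t, hx⟩) (by
      intro p t ht
      change π (p • t) ∈ W
      rw [← hsmul]
      exact hWinv _ _ ht)
  have hJb : IsBlockSet (liftGroup G π) J := hJ.elim (fun h => h.block) fun h => h.block
  have htr : ∀ (n : ℤ) (t : ℝ), liftGroup.translation (G := G) hπ n • t = t + n := fun _ _ => rfl
  -- a group element that does not move `π '' J` off itself has a lift that does not move `J` off
  -- itself
  have hliftJ : ∀ (g : G), ∀ t ∈ J, g • π t ∈ π '' J →
      ∃ p : liftGroup G π, p.1.1 = g ∧ p • t ∈ J := by
    rintro g t - ⟨s, hs, hst⟩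
    obtain ⟨F, hF⟩ := hlift g
    rw [hF t] at hst
    obtain ⟨m, hm⟩ := (hπ _ _).mp hst.symm
    refine ⟨liftGroup.translation hπ m * ⟨(g, F), hF⟩, one_mul g, ?_⟩
    rw [mul_smul, htr]
    change F t + m ∈ J
    rwa [← hm]
  by_cases hJu : J = Set.univ
  · right
    subst hJu
    refine ⟨Set.eq_univ_of_forall fun x => ?_, fun _ _ _ _ _ _ => trivial, ?_, ?_⟩
    · obtain ⟨t, rfl⟩ := hπs x
      exact hJW (Set.mem_univ t)
    · rcases hJ with hJ | hJ
      · have h1 := hJ (liftGroup.translation hπ 1) 0 trivial trivial 0 trivial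
        rw [htr] at h1
        norm_num at h1
      · intro x _ y _
        obtain ⟨t, rfl⟩ := hπs x
        obtain ⟨s, rfl⟩ := hπs y
        refine map_mem_closure hπc (hJ.dense t trivial (Set.mem_univ s)) ?_
        rintro _ ⟨p, rfl⟩
        exact ⟨p.1.1, hsmul p t⟩
    · intro g k x _ _ _
      obtain ⟨t, rfl⟩ := hπs x
      obtain ⟨F, hF⟩ := hlift g
      obtain ⟨K, hK⟩ := hlift k
      rcases hJ with hJ | hJ
      · rw [hK, hF, hF, hK]
        have h1 := hJ ⟨(g, F), hF⟩ (K t) trivial trivial (K t) trivial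
        have h2 := hJ ⟨(g, F), hF⟩ t trivial trivial t trivial
        change F (K t) = K t at h1
        change F t = t at h2
        rw [h1, h2]
      · have h1 := hJ.smul_comm ⟨(g, F), hF⟩ ⟨(k, K), hK⟩ t trivial trivial trivial
        change F (K t) = K (F t) at h1
        rw [hK, hF, hF, hK, h1]
  · left
    -- an integer translation that does not move `J` off itself is trivial
    have hinj : Set.InjOn π J := by
      intro s hs t ht hst
      obtain ⟨m, rfl⟩ := (hπ _ _).mp hst
      by_contra hne
      have hm : m ≠ 0 := by
        rintro rfl
        simp at hne
      refine hJu (Set.eq_univ_of_forall fun y => ?_)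
      have hfwd : ∀ k : ℕ, ∀ ε : ℤ, (ε = m ∨ ε = -m) → s + k * ε ∈ J := by
        intro k ε hε
        have hεJ : ∀ x ∈ J, x + ε ∈ J := by
          rcases hε with rfl | rfl
          · exact hJb (liftGroup.translation hπ ε) s hs ht
          · exact hJb (liftGroup.translation hπ (-m)) (s + m) ht (by
              rw [htr]
              push_cast
              rwa [add_neg_cancel_right])
        induction k with
        | zero => simpa using hs
        | succ k ih =>
          have := hεJ _ ih
          push_cast
          rwa [add_mul, one_mul, ← add_assoc]
      obtain ⟨k, hk⟩ := exists_nat_ge |y - s|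
      have hk' := abs_le.mp hk
      have hm1 : (1 : ℝ) ≤ |(m : ℝ)| := by exact_mod_cast Int.one_le_abs hm
      have hkm : (k : ℝ) ≤ k * |(m : ℝ)| := le_mul_of_one_le_right (Nat.cast_nonneg k) hm1
      have h1 := hfwd k m (.inl rfl)
      have h2 := hfwd k (-m) (.inr rfl)
      push_cast at h2
      rcases abs_cases (m : ℝ) with ⟨habs, -⟩ | ⟨habs, -⟩
      · rw [habs] at hkm
        exact hJoc.out h2 h1 ⟨by linarith, by linarith⟩
      · rw [habs] at hkm
        exact hJoc.out h1 h2 ⟨by linarith, by linarith⟩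
    refine ⟨π '' J, ?_, ⟨hπo J hJo, ?_⟩, ?_⟩
    · rintro _ ⟨t, ht, rfl⟩
      exact hJW ht
    · obtain ⟨e⟩ := nonempty_homeomorph_real hJo hJne hJoc
      have hemb : Topology.IsOpenEmbedding (fun t : J => π t) :=
        .of_continuous_injective_isOpenMap (hπc.comp continuous_subtype_val)
          (fun s t hst => Subtype.ext (hinj s.2 t.2 hst)) (hπo.comp hJo.isOpenMap_subtype_val)
      have hrange : Set.range (fun t : J => π t) = π '' J := (Set.image_eq_range π J).symm
      exact ⟨(Homeomorph.setCongr hrange).symm.trans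
        (hemb.isEmbedding.toHomeomorph.symm.trans e)⟩
    · rcases hJ with hJ | hJ
      · left
        rintro g _ ⟨t, ht, rfl⟩ hgt _ ⟨s, hs, rfl⟩
        obtain ⟨p, rfl, hp⟩ := hliftJ g t ht hgt
        rw [hsmul, hJ p t ht hp s hs]
      · right
        refine ⟨?_, ?_, ?_⟩
        · rintro g _ ⟨t, ht, rfl⟩ hgt _ ⟨s, hs, rfl⟩
          obtain ⟨p, rfl, hp⟩ := hliftJ g t ht hgt
          exact ⟨p • s, hJ.block p t ht hp s hs, (hsmul p s).symm⟩
        · rintro _ ⟨t, ht, rfl⟩ _ ⟨s, hs, rfl⟩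
          refine map_mem_closure hπc (hJ.dense t ht hs) ?_
          rintro _ ⟨p, rfl⟩
          exact ⟨p.1.1, hsmul p t⟩
        · rintro g k _ ⟨t, ht, rfl⟩ hgt hkt
          obtain ⟨p, rfl, hp⟩ := hliftJ g t ht hgt
          obtain ⟨q, rfl, hq⟩ := hliftJ k t ht hkt
          rw [hsmul, hsmul, hsmul, hsmul, hJ.smul_comm p q t ht hp hq]

end circle

theorem unitAddCircle_coe_eq_coe_iff (s t : ℝ) :
    (s : UnitAddCircle) = (t : UnitAddCircle) ↔ ∃ n : ℤ, t = s + n := by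
  rw [eq_comm, QuotientAddGroup.eq_iff_sub_mem, AddSubgroup.mem_zmultiples_iff]
  refine exists_congr fun n => ?_
  rw [zsmul_one, eq_sub_iff_add_eq, eq_comm, add_comm]

/-! ### Existence of interval decompositions -/

theorem exists_isIntervalDecomposition {G : Type u} [Group G] [Group.FG G]
    (hG : Group.IsVirtuallyNilpotent G) {M : Type v} [TopologicalSpace M] (hM : IsOneManifold M)
    (φ : G →* HomeoPlus M) : ∃ 𝓘 𝓜 : Set (Set M), IsIntervalDecomposition φ 𝓘 𝓜 := by
  have hsep : TopologicalSpace.SeparableSpace M := by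
    rcases hM with ⟨⟨e⟩⟩ | ⟨⟨e⟩⟩ | ⟨⟨e⟩⟩ | ⟨⟨e⟩⟩
    · exact e.symm.surjective.denseRange.separableSpace e.symm.continuous
    · exact e.symm.surjective.denseRange.separableSpace e.symm.continuous
    · exact e.symm.surjective.denseRange.separableSpace e.symm.continuous
    · have hcoe : Function.Surjective fun t : ℝ => (t : UnitAddCircle) :=
        QuotientAddGroup.mk_surjective
      exact (e.symm.surjective.comp hcoe).denseRange.separableSpace
        (e.symm.continuous.comp (AddCircle.continuous_mk' 1))
  let _ := toMulAction φ
  refine exists_isIntervalDecomposition_of_blocks φ fun W hWo hWne hWinv => ?_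
  have hor : ∀ g : G, IsOrientationPreserving (φ g : M ≃ₜ M) := fun g => (φ g).2
  rcases hM with ⟨⟨e⟩⟩ | ⟨⟨e⟩⟩ | ⟨⟨e⟩⟩ | ⟨⟨e⟩⟩
  · left
    refine exists_block_of_isEmbedding hG e.isEmbedding ?_ ?_ (fun g => (hor g).1 e)
      hWo hWne hWinv
    · rw [e.surjective.range_eq]
      exact Set.ordConnected_univ
    · rw [e.surjective.range_eq]
      simp
  · left
    have hrange : Set.range (fun x => (e x : ℝ)) = Set.Ico 0 1 := by
      rw [← Function.comp_def, e.surjective.range_comp, Subtype.range_coe]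
    refine exists_block_of_isEmbedding hG
      (Topology.IsEmbedding.subtypeVal.comp e.isEmbedding) ?_ ?_ (fun g => (hor g).2.1 e)
      hWo hWne hWinv
    · rw [Function.comp_def, hrange]
      exact Set.ordConnected_Ico
    · rw [Function.comp_def, hrange, interior_Ico, closure_Ioo zero_ne_one]
      exact Set.Ico_subset_Icc_self
  · left
    have hrange : Set.range (fun x => (e x : ℝ)) = Set.Icc 0 1 := by
      rw [← Function.comp_def, e.surjective.range_comp, Subtype.range_coe]
    refine exists_block_of_isEmbedding hG
      (Topology.IsEmbedding.subtypeVal.comp e.isEmbedding) ?_ ?_ (fun g => (hor g).2.2.1 e)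
      hWo hWne hWinv
    · rw [Function.comp_def, hrange]
      exact Set.ordConnected_Icc
    · rw [Function.comp_def, hrange, interior_Icc, closure_Ioo zero_ne_one]
  · have hcoe : Function.Surjective fun t : ℝ => (t : UnitAddCircle) :=
      QuotientAddGroup.mk_surjective
    have h := exists_block_of_covering hG (π := fun t : ℝ => e.symm (t : UnitAddCircle))
      (fun s t => by rw [e.symm.injective.eq_iff, unitAddCircle_coe_eq_coe_iff])
      (e.symm.continuous.comp (AddCircle.continuous_mk' 1))
      (e.symm.isOpenMap.comp QuotientAddGroup.isOpenMap_coe) (e.symm.surjective.comp hcoe)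
      (fun g => by
        obtain ⟨F, hF⟩ := (hor g).2.2.2 e
        refine ⟨F, fun t => ?_⟩
        rw [← hF t, e.symm_apply_apply]
        rfl) hWo hWne hWinv
    exact h.imp_right fun h => ⟨h.1, ⟨e⟩, h.2⟩

/-! ### Transport of interval decompositions by a conjugacy -/

section conjugacy

variable {M : Type v} [TopologicalSpace M] {G : Type u} [Group G]

theorem IsOneManifold.t2Space (hM : IsOneManifold M) : T2Space M := by
  rcases hM with ⟨⟨e⟩⟩ | ⟨⟨e⟩⟩ | ⟨⟨e⟩⟩ | ⟨⟨e⟩⟩ <;> exact e.symm.t2Space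

theorem sUnion_subset_sUnion_pieces (𝓤 : Set (Set M)) : ⋃₀ 𝓤 ⊆ ⋃₀ pieces 𝓤 := by
  rintro x ⟨U, hU, hx⟩
  exact ⟨connectedComponentIn U x, ⟨U, hU, x, hx, rfl⟩, mem_connectedComponentIn hx⟩

/-- A homeomorphism that intertwines the actions on a dense set is a conjugacy. -/
theorem Carries.conjugate [T2Space M] {h : M ≃ₜ M} {φ ψ : G →* HomeoPlus M}
    {𝓘 𝓜 𝓘' 𝓜' : Set (Set M)} (hφ : IsIntervalDecomposition φ 𝓘 𝓜)
    (hc : Carries h φ ψ 𝓘 𝓜 𝓘' 𝓜') : Conjugate φ ψ := by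
  refine ⟨h, fun g => congrFun (Continuous.ext_on hφ.dense
    (h.continuous.comp (φ g : M ≃ₜ M).continuous) ((ψ g : M ≃ₜ M).continuous.comp h.continuous) ?_)⟩
  rintro x (hx | hx)
  · obtain ⟨K, hK, hxK⟩ := sUnion_subset_sUnion_pieces 𝓘 hx
    exact hc.intertwines K (.inl hK) x hxK g
  · obtain ⟨K, hK, hxK⟩ := sUnion_subset_sUnion_pieces 𝓜 hx
    exact hc.intertwines K (.inr hK) x hxK g

theorem components_image (h : M ≃ₜ M) (U : Set M) :
    components (h '' U) = (fun K : Set M => h '' K) '' components U := by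
  ext K
  constructor
  · rintro ⟨_, ⟨x, hx, rfl⟩, rfl⟩
    exact ⟨_, ⟨x, hx, rfl⟩, h.image_connectedComponentIn hx⟩
  · rintro ⟨_, ⟨x, hx, rfl⟩, rfl⟩
    exact ⟨h x, ⟨x, hx, rfl⟩, h.image_connectedComponentIn hx⟩

theorem pieces_image (h : M ≃ₜ M) (𝓤 : Set (Set M)) :
    pieces ((fun U : Set M => h '' U) '' 𝓤) = (fun K : Set M => h '' K) '' pieces 𝓤 := by
  ext K
  constructor
  · rintro ⟨_, ⟨U, hU, rfl⟩, hK⟩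
    rw [components_image] at hK
    obtain ⟨K, hK, rfl⟩ := hK
    exact ⟨K, ⟨U, hU, hK⟩, rfl⟩
  · rintro ⟨K, ⟨U, hU, hK⟩, rfl⟩
    refine ⟨_, ⟨U, hU, rfl⟩, ?_⟩
    rw [components_image]
    exact ⟨K, hK, rfl⟩

/-- The equivariance is needed only on the set `K` itself. -/
theorem stabilizes_image_iff {h : M ≃ₜ M} {φ ψ : G →* HomeoPlus M} {K : Set M} {g : G}
    (hg : ∀ x ∈ K, h ((φ g : M ≃ₜ M) x) = (ψ g : M ≃ₜ M) (h x)) :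
    Stabilizes φ K g ↔ Stabilizes ψ (h '' K) g := by
  have h1 : (ψ g : M ≃ₜ M) '' (h '' K) = h '' ((φ g : M ≃ₜ M) '' K) := by
    rw [Set.image_image, Set.image_image]
    exact Set.image_congr fun x hx => (hg x hx).symm
  rw [Stabilizes, Stabilizes, h1, h.injective.image_injective.eq_iff]

theorem IsIntervalDecomposition.image {h : M ≃ₜ M} {φ ψ : G →* HomeoPlus M}
    (hc : ∀ (g : G) (x : M), h ((φ g : M ≃ₜ M) x) = (ψ g : M ≃ₜ M) (h x))
    {𝓘 𝓜 : Set (Set M)} (hφ : IsIntervalDecomposition φ 𝓘 𝓜) :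
    IsIntervalDecomposition ψ ((fun U : Set M => h '' U) '' 𝓘)
      ((fun U : Set M => h '' U) '' 𝓜) := by
  have hst : ∀ (K : Set M) (g : G), Stabilizes ψ (h '' K) g ↔ Stabilizes φ K g := fun K g =>
    (stabilizes_image_iff fun x _ => hc g x).symm
  have hdis : ∀ {U V : Set M}, Disjoint U V → Disjoint (h '' U) (h '' V) := fun hUV =>
    (Set.disjoint_image_iff h.injective).mpr hUV
  have him : ∀ (g : G) (K : Set M), (ψ g : M ≃ₜ M) '' (h '' K) = h '' ((φ g : M ≃ₜ M) '' K) := by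
    intro g K
    rw [Set.image_image, Set.image_image]
    exact Set.image_congr fun x _ => (hc g x).symm
  constructor
  · rw [← Set.image_union]
    exact hφ.countable.image _
  · rw [← Set.image_union]
    rintro _ ⟨U, hU, rfl⟩
    exact h.isOpenMap U (hφ.isOpen U hU)
  · rw [← Set.image_union]
    rintro _ ⟨U, hU, rfl⟩
    exact (hφ.nonempty U hU).image h
  · rintro _ ⟨U, hU, rfl⟩ _ ⟨V, hV, rfl⟩ hUV
    exact hdis (hφ.disjoint_I U hU V hV fun h1 => hUV (h1 ▸ rfl))
  · rintro _ ⟨U, hU, rfl⟩ _ ⟨V, hV, rfl⟩ hUV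
    exact hdis (hφ.disjoint_M U hU V hV fun h1 => hUV (h1 ▸ rfl))
  · rintro _ ⟨U, hU, rfl⟩ _ ⟨V, hV, rfl⟩
    exact hdis (hφ.disjoint_I_M U hU V hV)
  · rw [← Set.image_union]
    rintro _ ⟨U, hU, rfl⟩ g
    exact (hst U g).mpr (hφ.invariant U hU g)
  · rintro _ ⟨U, hU, rfl⟩ K hK
    rw [components_image] at hK
    obtain ⟨K, hK, rfl⟩ := hK
    exact (hφ.interval_I U hU K hK).image h
  · rintro _ ⟨U, hU, rfl⟩ K hK K' hK'
    rw [components_image] at hK hK'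
    obtain ⟨K, hK, rfl⟩ := hK
    obtain ⟨K', hK', rfl⟩ := hK'
    obtain ⟨g, hg⟩ := hφ.transitive U hU K hK K' hK'
    exact ⟨g, by rw [him, hg]⟩
  · rintro _ ⟨U, hU, rfl⟩ K hK g hg x hx
    rw [components_image] at hK
    obtain ⟨K, hK, rfl⟩ := hK
    obtain ⟨x, hx, rfl⟩ := hx
    rw [← hc, hφ.trivial U hU K hK g ((hst K g).mp hg) x hx]
  · rintro _ ⟨V, hV, rfl⟩
    rcases hφ.interval_M V hV with h1 | ⟨rfl, h1⟩
    · left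
      intro K hK
      rw [components_image] at hK
      obtain ⟨K, hK, rfl⟩ := hK
      exact (h1 K hK).image h
    · exact .inr ⟨Set.image_univ_of_surjective h.surjective, h1⟩
  · rintro _ ⟨V, hV, rfl⟩ _ ⟨x, hx, rfl⟩ _ ⟨y, hy, rfl⟩
    refine map_mem_closure h.continuous (hφ.minimal V hV x hx hy) ?_
    rintro _ ⟨g, rfl⟩
    exact ⟨g, (hc g x).symm⟩
  · rintro _ ⟨V, hV, rfl⟩ K hK g k hg hk x hx
    rw [components_image] at hK
    obtain ⟨K, hK, rfl⟩ := hK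
    obtain ⟨x, hx, rfl⟩ := hx
    rw [← hc, ← hc, ← hc, ← hc,
      hφ.abelian V hV K hK g k ((hst K g).mp hg) ((hst K k).mp hk) x hx]
  · have h1 : ⋃₀ ((fun U : Set M => h '' U) '' 𝓘) ∪ ⋃₀ ((fun U : Set M => h '' U) '' 𝓜) =
        h '' (⋃₀ 𝓘 ∪ ⋃₀ 𝓜) := by
      rw [Set.image_union, Set.sUnion_image, Set.sUnion_image, Set.image_sUnion, Set.image_sUnion,
        Set.sUnion_image, Set.sUnion_image]
    rw [h1]
    exact h.surjective.denseRange.dense_image h.continuous hφ.dense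

theorem Conjugate.exists_carries {φ ψ : G →* HomeoPlus M} (hc : Conjugate φ ψ)
    {𝓘 𝓜 : Set (Set M)} (hφ : IsIntervalDecomposition φ 𝓘 𝓜) :
    ∃ (𝓘' 𝓜' : Set (Set M)) (h : M ≃ₜ M),
      IsIntervalDecomposition ψ 𝓘' 𝓜' ∧ Carries h φ ψ 𝓘 𝓜 𝓘' 𝓜' := by
  obtain ⟨h, hh⟩ := hc
  exact ⟨_, _, h, hφ.image hh, (pieces_image h 𝓘).symm, (pieces_image h 𝓜).symm,
    fun _ _ x _ g => hh g x⟩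

end conjugacy

/-! ### Translation numbers on minimal intervals -/

section translation

variable {M : Type v} [TopologicalSpace M] {G : Type u} [Group G]

/-- The stabilizer of a minimal interval has dense orbits in the interval: an orbit of the whole
group can return to the interval only by an element of the stabilizer. -/
theorem IsIntervalDecomposition.exists_stabilizes_mem {φ : G →* HomeoPlus M}
    {𝓘 𝓜 : Set (Set M)} (hφ : IsIntervalDecomposition φ 𝓘 𝓜) {K : Set M} (hK : K ∈ pieces 𝓜)
    (hKo : IsOpen K) {x y : M} (hx : x ∈ K) (hy : y ∈ K) {U : Set M} (hU : IsOpen U)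
    (hyU : y ∈ U) : ∃ g : G, Stabilizes φ K g ∧ (φ g : M ≃ₜ M) x ∈ U := by
  let _ := toMulAction φ
  have : ContinuousConstSMul G M := ⟨fun g => (φ g : M ≃ₜ M).continuous⟩
  obtain ⟨V, hV, x₀, hx₀, rfl⟩ := hK
  have hsub := connectedComponentIn_subset V x₀
  obtain ⟨_, hg, g, rfl⟩ := mem_closure_iff.mp (hφ.minimal V hV x (hsub hx) (hsub hy)) _
    (hU.inter hKo) ⟨hyU, hy⟩
  have hVinv : ∀ g : G, ∀ x ∈ V, g • x ∈ V := by
    intro g x hx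
    have h1 : (φ g : M ≃ₜ M) '' V = V := hφ.invariant V (.inr hV) g
    have h2 : g • x ∈ (φ g : M ≃ₜ M) '' V := ⟨x, hx, rfl⟩
    rwa [h1] at h2
  exact ⟨g, (isBlockSet_connectedComponentIn hVinv x₀).smul_eq hx hg.2, hg.1⟩

theorem IsIntervalDecomposition.exists_actsByTranslations {φ : G →* HomeoPlus M}
    {𝓘 𝓜 : Set (Set M)} (hφ : IsIntervalDecomposition φ 𝓘 𝓜) {K : Set M} (hK : K ∈ pieces 𝓜)
    (hKi : IsOpenInterval K) :
    ∃ (p : K ≃ₜ ℝ) (τ : G → ℝ), ActsByTranslations φ K p τ := by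
  classical
  let _ := toMulAction φ
  have : ContinuousConstSMul G M := ⟨fun g => (φ g : M ≃ₜ M).continuous⟩
  obtain ⟨e⟩ := hKi.2
  have hmem : ∀ g : MulAction.stabilizer G K, ∀ x ∈ K, g • x ∈ K := by
    intro g x hx
    have h1 : (g : G) • K = K := g.2
    have h2 : (g : G) • x ∈ (g : G) • K := Set.smul_mem_smul_set hx
    rwa [h1] at h2
  let S : SubMulAction (MulAction.stabilizer G K) M := ⟨K, fun g {x} hx => hmem g x hx⟩
  have : ContinuousConstSMul (MulAction.stabilizer G K) S :=
    ⟨fun g => ((continuous_const_smul (g : G)).comp continuous_subtype_val).subtype_mk _⟩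
  obtain ⟨p, τ, hp⟩ := exists_homeomorph_translation (H := MulAction.stabilizer G K) (Y := S) e
    (by
      intro g h y
      obtain ⟨V, hV, hKV⟩ := hK
      exact Subtype.ext (hφ.abelian V hV K hKV g h g.2 h.2 y y.2)) (by
      intro y
      rw [dense_iff_closure_eq, Set.eq_univ_iff_forall]
      intro z
      rw [mem_closure_iff]
      rintro _ ⟨U, hU, rfl⟩ hz
      obtain ⟨g, hg, hgU⟩ := hφ.exists_stabilizes_mem hK hKi.1 y.2 z.2 hU hz
      exact ⟨(⟨g, hg⟩ : MulAction.stabilizer G K) • y, hgU, ⟨_, rfl⟩⟩)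
  obtain ⟨τ', hτ'⟩ : ∃ τ' : G → ℝ, ∀ (g : G) (hg : g ∈ MulAction.stabilizer G K),
      τ' g = τ ⟨g, hg⟩ :=
    ⟨fun g => if hg : g ∈ MulAction.stabilizer G K then τ ⟨g, hg⟩ else 0, fun g hg => dif_pos hg⟩
  refine ⟨p, τ', fun g hg x y hxy => ?_⟩
  have h1 : y = (⟨g, hg⟩ : MulAction.stabilizer G K) • (show S from x) := Subtype.ext hxy
  have h2 := hp ⟨g, hg⟩ x
  rw [← h1] at h2
  exact h2.trans (congrArg (p x + ·) (hτ' g hg).symm)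

theorem IsIntervalDecomposition.dense_translations {φ : G →* HomeoPlus M}
    {𝓘 𝓜 : Set (Set M)} (hφ : IsIntervalDecomposition φ 𝓘 𝓜) {K : Set M} (hK : K ∈ pieces 𝓜)
    (hKo : IsOpen K) {p : K ≃ₜ ℝ} {τ : G → ℝ} (hp : ActsByTranslations φ K p τ) :
    Dense {r | ∃ g, Stabilizes φ K g ∧ τ g = r} := by
  rw [dense_iff_inter_open]
  rintro U hU ⟨r, hr⟩
  let x := p.symm 0
  -- points of `K` with coordinate in `U`, as an open subset of the manifold
  have hUK : IsOpen (Subtype.val '' (p ⁻¹' U)) :=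
    hKo.isOpenMap_subtype_val _ (hU.preimage p.continuous)
  obtain ⟨g, hg, y, hyU, hy⟩ := hφ.exists_stabilizes_mem hK hKo x.2 (p.symm r).2 hUK
    ⟨p.symm r, by simpa using hr, rfl⟩
  have h1 := hp g hg x y hy
  rw [p.apply_symm_apply, zero_add] at h1
  exact ⟨τ g, h1 ▸ hyU, g, hg, rfl⟩

/-- The coordinate change given by `h` is affine, and `c` is its slope. -/
theorem Carries.exists_eq_mul {φ ψ : G →* HomeoPlus M} {𝓘 𝓜 𝓘' 𝓜' : Set (Set M)} {h : M ≃ₜ M}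
    (hφ : IsIntervalDecomposition φ 𝓘 𝓜) (hc : Carries h φ ψ 𝓘 𝓜 𝓘' 𝓜') {K : Set M}
    (hK : K ∈ pieces 𝓜) (hKo : IsOpen K) {p : K ≃ₜ ℝ} {τ : G → ℝ} {q : (h '' K) ≃ₜ ℝ}
    {σ : G → ℝ} (hp : ActsByTranslations φ K p τ) (hq : ActsByTranslations ψ (h '' K) q σ) :
    ∃ c : ℝ, c ≠ 0 ∧ ∀ g : G, Stabilizes φ K g → σ g = c * τ g := by
  have hst : ∀ g : G, Stabilizes φ K g ↔ Stabilizes ψ (h '' K) g := fun g =>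
    stabilizes_image_iff fun x hx => hc.intertwines K (.inr hK) x hx g
  -- the coordinate change `k` conjugates a dense group of translations to translations
  let k : ℝ ≃ₜ ℝ := p.symm.trans ((h.image K).trans q)
  have hk : ∀ g : G, Stabilizes φ K g → ∀ t, k (t + τ g) = k t + σ g := by
    intro g hg t
    obtain ⟨x, rfl⟩ := p.surjective t
    have hgx : (φ g : M ≃ₜ M) x ∈ K := by
      have h1 : (φ g : M ≃ₜ M) '' K = K := hg
      have h2 : (φ g : M ≃ₜ M) x ∈ (φ g : M ≃ₜ M) '' K := ⟨x, x.2, rfl⟩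
      rwa [h1] at h2
    rw [← hp g hg x ⟨_, hgx⟩ rfl]
    change q (h.image K (p.symm (p _))) = q (h.image K (p.symm (p x))) + σ g
    rw [p.symm_apply_apply, p.symm_apply_apply]
    exact hq g ((hst g).mp hg) _ _ (hc.intertwines K (.inr hK) x x.2 g)
  have haff := eq_affine_of_dense_translations k.continuous (hφ.dense_translations hK hKo hp) (by
    rintro _ ⟨g, hg, rfl⟩
    exact ⟨σ g, hk g hg⟩)
  refine ⟨k 1 - k 0, sub_ne_zero.mpr fun h1 => one_ne_zero (k.injective h1), fun g hg => ?_⟩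
  have h1 := hk g hg 0
  rw [zero_add, haff (τ g)] at h1
  linarith

end translation

end OneDimAction

theorem mainTheorem2 {G : Type*} [Group G] [Group.FG G] (hG : Group.IsVirtuallyNilpotent G)
    {M : Type*} [TopologicalSpace M] (hM : OneDimAction.IsOneManifold M)
    (φ ψ : G →* OneDimAction.HomeoPlus M) :
    -- conjugacy in terms of decompositions
    (OneDimAction.Conjugate φ ψ ↔
      ∃ (𝓘 𝓜 𝓘' 𝓜' : Set (Set M)) (h : M ≃ₜ M),
        OneDimAction.IsIntervalDecomposition φ 𝓘 𝓜 ∧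
        OneDimAction.IsIntervalDecomposition ψ 𝓘' 𝓜' ∧
        OneDimAction.Carries h φ ψ 𝓘 𝓜 𝓘' 𝓜') ∧
    -- the decomposition of the first action may be prescribed
    (∀ 𝓘 𝓜 : Set (Set M), OneDimAction.IsIntervalDecomposition φ 𝓘 𝓜 →
      (OneDimAction.Conjugate φ ψ ↔
        ∃ (𝓘' 𝓜' : Set (Set M)) (h : M ≃ₜ M),
          OneDimAction.IsIntervalDecomposition ψ 𝓘' 𝓜' ∧
          OneDimAction.Carries h φ ψ 𝓘 𝓜 𝓘' 𝓜')) ∧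
    -- the actions on corresponding minimal intervals
    (∀ (𝓘 𝓜 𝓘' 𝓜' : Set (Set M)) (h : M ≃ₜ M),
      OneDimAction.IsIntervalDecomposition φ 𝓘 𝓜 →
      OneDimAction.IsIntervalDecomposition ψ 𝓘' 𝓜' →
      OneDimAction.Carries h φ ψ 𝓘 𝓜 𝓘' 𝓜' →
      ∀ K ∈ OneDimAction.pieces 𝓜, OneDimAction.IsOpenInterval K →
        (∀ g : G, OneDimAction.Stabilizes φ K g ↔ OneDimAction.Stabilizes ψ (h '' K) g) ∧
        (∃ (p : K ≃ₜ ℝ) (τ : G → ℝ), OneDimAction.ActsByTranslations φ K p τ) ∧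
        (∃ (q : (h '' K) ≃ₜ ℝ) (σ : G → ℝ), OneDimAction.ActsByTranslations ψ (h '' K) q σ) ∧
        (∀ (p : K ≃ₜ ℝ) (τ : G → ℝ) (q : (h '' K) ≃ₜ ℝ) (σ : G → ℝ),
          OneDimAction.ActsByTranslations φ K p τ →
          OneDimAction.ActsByTranslations ψ (h '' K) q σ →
          ∃ c : ℝ, c ≠ 0 ∧ ∀ g : G, OneDimAction.Stabilizes φ K g → σ g = c * τ g)) := by
  have := hM.t2Space
  refine ⟨⟨fun hconj => ?_, ?_⟩, fun 𝓘 𝓜 hφ => ⟨fun hconj => hconj.exists_carries hφ, ?_⟩, ?_⟩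
  · obtain ⟨𝓘, 𝓜, hφ⟩ := OneDimAction.exists_isIntervalDecomposition hG hM φ
    obtain ⟨𝓘', 𝓜', h, hψ, hc⟩ := hconj.exists_carries hφ
    exact ⟨𝓘, 𝓜, 𝓘', 𝓜', h, hφ, hψ, hc⟩
  · rintro ⟨𝓘, 𝓜, 𝓘', 𝓜', h, hφ, -, hc⟩
    exact hc.conjugate hφ
  · rintro ⟨𝓘', 𝓜', h, -, hc⟩
    exact hc.conjugate hφ
  · intro 𝓘 𝓜 𝓘' 𝓜' h hφ hψ hc K hK hKi
    have hK' : h '' K ∈ OneDimAction.pieces 𝓜' := hc.image_M ▸ ⟨K, hK, rfl⟩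
    exact ⟨fun g => OneDimAction.stabilizes_image_iff fun x hx => hc.intertwines K (.inr hK) x hx g,
      hφ.exists_actsByTranslations hK hKi, hψ.exists_actsByTranslations hK' (hKi.image h),
      fun p τ q σ hp hq => hc.exists_eq_mul hφ hK hKi.1 hp hq⟩
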